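/- **Setting.** For each $t\in[0,1]$ let $\nu_t$ be a probability measure on $\overline{\mathbb R}=\mathbb R\cup\{\pm\infty\}$. It defines a binary memoryless symmetric (BMS) channel $W(t)$: the input $x\in\{\pm1\}^N$ produces the output $Y(t)=(x_0Z_0,\dots,x_{N-1}Z_{N-1})$, where $Z_0,\dots,Z_{N-1}$ are i.i.d. with law $\nu_t$ and independent of the input. Entropies are in bits, $\mathrm{mmse}(X\mid Y)=\mathbb E[(X-\mathbb E[X\mid Y])^2]$, and $C(t)$ is the Shannon capacity of $W(t)$, i.e. the supremum of $I(X;Y)$ over all distributions of a single input $X\in\{\pm1\}$ with output $Y$. Let $\mathcal H(t)=H(X_{\mathrm u}\mid Y_{\mathrm u}(t))$ and $\mathcal M(t)=\mathrm{mmse}(X_{\mathrm u}\mid Y_{\mathrm u}(t))$, where $X_{\mathrm u}$ is uniform on $\{\pm1\}$ and $Y_{\mathrm u}(t)$ is its observation through $W(t)$. Assume that - $W(t)$ is stochastically degraded with respect to $W(s)$ whenever $0\le s\le t\le1$, $W(0)$ is perfect (the output determines the input) and $W(1)$ is uninformative (the law of the output does not depend on the input); - $\mathcal H$ is absolutely continuous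 on $[0,1]$; - $\mathcal M(t)=t$ for all $t\in[0,1]$. Let $\mathcal C\subseteq\{0,1\}^N$, $N\ge1$, be a non-empty binary code (not necessarily linear) of rate $R=\frac1N\log_2|\mathcal C|$, and let $X=((-1)^{c_0},\dots,(-1)^{c_{N-1}})$ with $c$ uniform on $\mathcal C$. Assume that the code has transitive symmetry: the group of coordinate permutations that preserve the law of $X$ is transitive on $\{0,\dots,N-1\}$. Let $M(t)=\mathrm{mmse}(X_i\mid Y_{\sim i}(t))$ be the extrinsic MMSE, where $Y_{\sim i}(t)$ is the output vector without its $i$-th entry; by transitivity it is the same for all $i$, and the claims below hold for every $i$. Let $\kappa(t)=\sup_{s\in[t,1]}\mathcal H'(s)\in[0,\infty]$, the supremum being over the points at which $\mathcal H$ is differentiable. Let $h_b(p)=-p\log_2p-(1-p)\log_2(1-p)$, let $h_b^{-1}\colon[0,1]\to[0,1/2]$ be the inverse of its restriction to $[0,1/2]$, and let $\psi(u)=1-(1-2h_b^{-1}(u))^2$ for $u\in[0,1]$. **Claim.** There is a unique $t_R\in[0,1]$ with $C(t_R)=R$, and $t_R\in(0,1)$ if $0<R<1$. The function $M(1-M)$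 is integrable on $[0,1]$. For every $t\in[0,t_R)$ we have $C(t)>R$ and $$M(t)\le\frac{\kappa(t)\int_t^1M(s)(1-M(s))\,ds}{C(t)-R}$$ (with the convention $\infty\cdot0=0$). The function $\psi$ is non-negative and strictly increasing on $[0,1]$, and for every $t\in(t_R,1]$ we have $\int_{t_R}^t\psi(R-C(s))\,ds>0$ and $$M(t)\ge1-\frac{\int_{t_R}^tM(s)(1-M(s))\,ds}{\int_{t_R}^t\psi(R-C(s))\,ds}.$$ -/

import Mathlib

open MeasureTheory ProbabilityTheory Set

noncomputable section

namespace BMS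

/-! ### Estimation and information quantities of random variables -/

/-- Minimum mean-squared error `‖X - E[X | Y]‖₂²` of estimating the real random variable `X`
from the observation `Y`. -/
def mmse {Ω E : Type*} [MeasurableSpace Ω] [mE : MeasurableSpace E] (P : Measure Ω)
    (X : Ω → ℝ) (Y : Ω → E) : ℝ :=
  ∫ ω, (X ω - (P[X | mE.comap Y]) ω) ^ 2 ∂P

/-- Shannon entropy `H(X)`, in bits, of a random variable with a finite alphabet. -/
def entropy {Ω A : Type*} [MeasurableSpace Ω] [Fintype A] (P : Measure Ω) (X : Ω → A) : ℝ :=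
  (∑ a, Real.negMulLog (P.real (X ⁻¹' {a}))) / Real.log 2

/-- Conditional Shannon entropy `H(X | Y)`, in bits: the expectation of the entropy of the
conditional distribution `a ↦ P(X = a | Y)`. -/
def condEntropy {Ω A E : Type*} [MeasurableSpace Ω] [Fintype A] [mE : MeasurableSpace E]
    (P : Measure Ω) (X : Ω → A) (Y : Ω → E) : ℝ :=
  (∫ ω, ∑ a, Real.negMulLog ((P⟦X ⁻¹' {a} | mE.comap Y⟧) ω) ∂P) / Real.log 2

/-- Mutual information `I(X; Y) = H(X) - H(X | Y)`, in bits. -/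
def mutualInfo {Ω A E : Type*} [MeasurableSpace Ω] [Fintype A] [MeasurableSpace E]
    (P : Measure Ω) (X : Ω → A) (Y : Ω → E) : ℝ :=
  entropy P X - condEntropy P X Y

/-! ### A single use of a binary symmetric channel

Code symbols are elements of `Bool` (`false` is `0`, `true` is `1`). The symbol `b` is sent as the
channel input `(-1)^b`. A binary memoryless symmetric channel with output alphabet the extended
reals is given by the law `ν` of its output for the input `+1`: the output for the input `x` is
`x * Z` with `Z` distributed according to `ν`. -/

/-- The channel input `(-1)^b`. -/
def bpsk (b : Bool) : ℝ := if b then -1 else 1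

/-- The channel output `x * z` for the code symbol `b`, where `x = (-1)^b`. -/
def output (b : Bool) (z : EReal) : EReal := (bpsk b : EReal) * z

/-- The transition probability of the channel: law of the output given the code symbol `b`. -/
def transition (ν : Measure EReal) (b : Bool) : Measure EReal := ν.map (output b)

/-- Law of the pair (code symbol, noise) for a code symbol with law `p`. -/
def singleLaw (p : Measure Bool) (ν : Measure EReal) : Measure (Bool × EReal) := p.prod ν

/-- The output of the single channel use, as a random variable on `Bool × EReal`. -/
def singleOutput (ω : Bool × EReal) : EReal := output ω.1 ω.2

/-- Uniform distribution on the two code symbols. -/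
def unifBit : Measure Bool := uniformOn Set.univ

/-- Conditional entropy `H(X_u | Y_u)` of a uniform input given the channel output. -/
def chanEntropy (ν : Measure EReal) : ℝ :=
  condEntropy (singleLaw unifBit ν) (fun ω => ω.1) singleOutput

/-- `mmse(X_u | Y_u)` of a uniform input given the channel output. -/
def chanMMSE (ν : Measure EReal) : ℝ :=
  mmse (singleLaw unifBit ν) (fun ω => bpsk ω.1) singleOutput

/-- Shannon capacity: supremum of the mutual information over all input distributions. -/
def capacity (ν : Measure EReal) : ℝ :=
  ⨆ p : ProbabilityMeasure Bool,
    mutualInfo (singleLaw (p : Measure Bool) ν) (fun ω => ω.1) singleOutput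

/-- The channel of `ν'` is (stochastically) degraded with respect to the channel of `ν`: it is the
composition of the channel of `ν` with a further channel. -/
def IsDegraded (ν' ν : Measure EReal) : Prop :=
  ∃ K : Kernel EReal EReal, IsMarkovKernel K ∧
    ∀ b, transition ν' b = (transition ν b).bind K

/-- Perfect channel: the input is determined by the output. -/
def IsPerfect (ν : Measure EReal) : Prop :=
  ∃ φ : EReal → Bool, Measurable φ ∧ ∀ b, ∀ᵐ y ∂(transition ν b), φ y = b

/-- Uninformative channel: the law of the output does not depend on the input. -/
def IsUninformative (ν : Measure EReal) : Prop :=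
  ∀ b b', transition ν b = transition ν b'

/-- The standing assumption on a family of channels with parameter `t ∈ [0,1]`: it is ordered by
degradation from a perfect to an uninformative channel, its entropy function is absolutely
continuous on `[0,1]`, and its MMSE function is the identity. Nothing is required of `ν t` for `t`
outside `[0,1]`. -/
structure IsAdmissibleFamily (ν : ℝ → Measure EReal) : Prop where
  degraded : ∀ s t, 0 ≤ s → s ≤ t → t ≤ 1 → IsDegraded (ν t) (ν s)
  perfect : IsPerfect (ν 0)
  uninformative : IsUninformative (ν 1)
  absolutelyContinuous : AbsolutelyContinuousOnInterval (fun t => chanEntropy (ν t)) 0 1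
  mmse_eq : ∀ t ∈ Icc (0 : ℝ) 1, chanMMSE (ν t) = t

/-- `κ(t) = sup_{s ∈ [t,1]} 𝓗'(s)`, with values in `[0,∞]`, where `𝓗` is the entropy function on
`[0,1]`. As `𝓗` is non-decreasing, points where it is not differentiable (which contribute the
value `0`) do not affect the supremum. -/
def kappa (ν : ℝ → Measure EReal) (t : ℝ) : ENNReal :=
  ⨆ s ∈ Icc t 1, ENNReal.ofReal (derivWithin (fun u => chanEntropy (ν u)) (Icc 0 1) s)

/-! ### Codes -/

variable {N : ℕ}

/-- Rate of a binary code of length `N`. -/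
def rate (C : Finset (Fin N → Bool)) : ℝ := Real.logb 2 C.card / N

/-- Uniform distribution on the codewords. -/
def codeLaw (C : Finset (Fin N → Bool)) : Measure (Fin N → Bool) :=
  uniformOn (C : Set (Fin N → Bool))

/-- A random vector with law `μ` has transitive symmetry: the permutations of the coordinates that
preserve its law act transitively. -/
def HasTransitiveSymmetry (μ : Measure (Fin N → Bool)) : Prop :=
  ∀ i j : Fin N, ∃ π : Equiv.Perm (Fin N), μ.map (fun x k => x (π k)) = μ ∧ π i = j

/-- Law of (codeword, noise vector): a uniform codeword and an independent noise vector with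
independent entries of law `ν`. -/
def blockLaw (C : Finset (Fin N → Bool)) (ν : Measure EReal) :
    Measure ((Fin N → Bool) × (Fin N → EReal)) :=
  (codeLaw C).prod (Measure.pi fun _ => ν)

/-- The channel outputs `Y_j = X_j * Z_j` at all positions `j ≠ i`. -/
def extrinsicOutput (i : Fin N) (ω : (Fin N → Bool) × (Fin N → EReal)) : {j // j ≠ i} → EReal :=
  fun j => output (ω.1 j) (ω.2 j)

/-- Extrinsic MMSE `M_i = ‖X_i - E[X_i | Y_{∼i}]‖₂²`. -/
def extrinsicMMSE (C : Finset (Fin N → Bool)) (ν : Measure EReal) (i : Fin N) : ℝ :=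
  mmse (blockLaw C ν) (fun ω => bpsk (ω.1 i)) (extrinsicOutput i)

/-! ### The function `ψ` -/

/-- Binary entropy function, in bits. -/
def hb (p : ℝ) : ℝ := -p * Real.logb 2 p - (1 - p) * Real.logb 2 (1 - p)

/-- Inverse of the bijection `hb : [0,1/2] → [0,1]`. -/
def hbInv (u : ℝ) : ℝ := Function.invFunOn hb (Icc 0 (1 / 2)) u

/-- `ψ(u) = 1 - (1 - 2 h_b⁻¹(u))²`, used for `u ∈ [0,1]`. -/
def psi (u : ℝ) : ℝ := 1 - (1 - 2 * hbInv u) ^ 2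

end BMS

end

/-!
A channel enters only through the law on `[-1,1]` of the *bias*, the posterior mean of a uniform
symbol given its observation: the likelihood of a word `x` is proportional to
`∏ j, (1 + (-1) ^ x j * d j)` in the biases `d`, and degradation makes the law of the bias smaller
in the convex order. By the chain rule, replacing the channel at position `i` changes `H(X | Y)` by
a difference of mutual informations `I(X_i; Y_i | Y_{∼i})`. Let `h(d)` be the entropy of a sign of
mean `d`. For a symbol of posterior mean `τ` the information is `E h(τ d) - E h(d)`, the law of `d`
being symmetric. Since `h(τ d)` is concave in `d` and `h(τ d) - τ² h(d)` is convex, replacing the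
channels one position at a time gives `M · Δ𝓗 ≤ ΔH(X | Y) / N ≤ Δ𝓗`, with `M` the extrinsic MMSE of
the better channel.

Hence `∫ M 𝓗' ≤ R` over `[t,1]`, while `∫ 𝓗' = C(t)`, so that `C(t) - R ≤ ∫ (1 - M) 𝓗'`; multiplying
by `M(t) ≤ M` and using `𝓗' ≤ κ(t)` gives the upper bound. For the lower bound, compare with the
perfect channel instead: Jensen's inequality for `h ∘ √` gives `H(X | Y(s)) / N ≤ h(√(1 - M(s)))`,
and `R - C(s) ≤ H(X | Y(s)) / N`. Thus `ψ(R - C(s)) ≤ M(s)`, which is multiplied by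
`1 - M(t) ≤ 1 - M(s)` and integrated.
-/

namespace BMS

open Real Function

/-! ### The entropy of a sign -/

/-- Entropy, in nats, of a `±1`-valued random variable with mean `d`. -/
noncomputable def signEntropy (d : ℝ) : ℝ := binEntropy ((1 - d) / 2)

lemma signEntropy_eq_negMulLog (d : ℝ) :
    signEntropy d = log 2 + (negMulLog (1 + d) + negMulLog (1 - d)) / 2 := by
  have halve (x : ℝ) : negMulLog (x / 2) = (negMulLog x + x * log 2) / 2 := by
    rw [div_eq_mul_inv, negMulLog_mul]
    simp only [negMulLog, log_inv]
    ring
  rw [signEntropy, binEntropy_eq_negMulLog_add_negMulLog_one_sub,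
    show 1 - (1 - d) / 2 = (1 + d) / 2 by ring, halve, halve]
  ring

@[fun_prop]
lemma continuous_signEntropy : Continuous signEntropy := by
  unfold signEntropy; fun_prop

@[simp]
lemma signEntropy_zero : signEntropy 0 = log 2 := by
  rw [signEntropy, sub_zero, one_div, binEntropy_two_inv]

@[simp]
lemma signEntropy_one : signEntropy 1 = 0 := by simp [signEntropy]

@[simp]
lemma signEntropy_neg (d : ℝ) : signEntropy (-d) = signEntropy d := by
  rw [signEntropy, signEntropy, ← binEntropy_one_sub]
  ring_nf

lemma signEntropy_abs (d : ℝ) : signEntropy |d| = signEntropy d := by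
  rcases abs_choice d with h | h <;> simp only [h, signEntropy_neg]

lemma one_sub_sq_pos {d : ℝ} (hd : d ∈ Ioo (-1 : ℝ) 1) : 0 < 1 - d ^ 2 := by
  nlinarith [hd.1, hd.2]

lemma mul_mem_Ioo {τ d : ℝ} (hτ : τ ∈ Icc (-1 : ℝ) 1) (hd : d ∈ Ioo (-1 : ℝ) 1) :
    τ * d ∈ Ioo (-1 : ℝ) 1 := by
  rw [mem_Ioo, ← abs_lt, abs_mul]
  exact mul_lt_one_of_nonneg_of_lt_one_right (abs_le.2 hτ) (abs_nonneg d) (abs_lt.2 hd)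

lemma hasDerivAt_signEntropy {d : ℝ} (hd : d ∈ Ioo (-1 : ℝ) 1) :
    HasDerivAt signEntropy (-artanh d) d := by
  have hp : 1 + d ≠ 0 := by linarith [hd.1]
  have hm : 1 - d ≠ 0 := by linarith [hd.2]
  have hlin : HasDerivAt (fun x : ℝ => (1 - x) / 2) (-1 / 2) d :=
    ((hasDerivAt_id d).const_sub 1).div_const 2
  refine ((hasDerivAt_binEntropy (by simpa using hm) (by linarith [hd.1])).comp d
    hlin).congr_deriv ?_
  rw [artanh_eq_half_log (Ioo_subset_Icc_self hd), show 1 - (1 - d) / 2 = (1 + d) / 2 by ring,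
    log_div hp two_ne_zero, log_div hm two_ne_zero, log_div hp hm]
  ring

lemma hasDerivAt_artanh {d : ℝ} (hd : d ∈ Ioo (-1 : ℝ) 1) :
    HasDerivAt artanh (1 / (1 - d ^ 2)) d := by
  have hp : 1 + d ≠ 0 := by linarith [hd.1]
  have hm : 1 - d ≠ 0 := by linarith [hd.2]
  have hlog : HasDerivAt (fun x => 1 / 2 * log ((1 + x) / (1 - x))) (1 / (1 - d ^ 2)) d := by
    refine (((((hasDerivAt_id d).const_add 1).div ((hasDerivAt_id d).const_sub 1) hm).log
      (div_ne_zero hp hm)).const_mul (1 / 2)).congr_deriv ?_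
    have := (one_sub_sq_pos hd).ne'
    simp only [id, Pi.div_apply]
    field_simp
    ring
  refine hlog.congr_of_eventuallyEq ?_
  filter_upwards [Ioo_mem_nhds hd.1 hd.2] with x hx
  exact artanh_eq_half_log (Ioo_subset_Icc_self hx)

lemma concaveOn_signEntropy : ConcaveOn ℝ (Icc (-1) 1) signEntropy := by
  refine ⟨convex_Icc _ _, fun x hx y hy a b ha hb hab => ?_⟩
  have h := strictConcave_binEntropy.concaveOn.2 (x := (1 - x) / 2) (y := (1 - y) / 2)
    ⟨by linarith [hx.2], by linarith [hx.1]⟩ ⟨by linarith [hy.2], by linarith [hy.1]⟩ ha hb hab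
  have hmid : a • ((1 - x) / 2) + b • ((1 - y) / 2) = (1 - (a • x + b • y)) / 2 := by
    simp only [smul_eq_mul]
    linear_combination hab / 2
  rwa [hmid] at h

lemma concaveOn_signEntropy_mul {τ : ℝ} (hτ : τ ∈ Icc (-1 : ℝ) 1) :
    ConcaveOn ℝ (Icc (-1) 1) (fun d => signEntropy (τ * d)) := by
  refine (concaveOn_signEntropy.comp_linearMap (LinearMap.mul ℝ ℝ τ)).subset (fun d hd => ?_)
    (convex_Icc _ _)
  rw [mem_preimage, LinearMap.mul_apply', mem_Icc, ← abs_le, abs_mul]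
  exact mul_le_one₀ (abs_le.2 hτ) (abs_nonneg d) (abs_le.2 hd)

lemma concaveOn_sq_mul_signEntropy_sub {τ : ℝ} (hτ : τ ∈ Icc (-1 : ℝ) 1) :
    ConcaveOn ℝ (Icc (-1) 1) (fun d => τ ^ 2 * signEntropy d - signEntropy (τ * d)) := by
  refine concaveOn_of_hasDerivWithinAt2_nonpos (convex_Icc _ _)
    (f' := fun d => τ ^ 2 * -artanh d - -artanh (τ * d) * τ)
    (f'' := fun d => τ ^ 2 * -(1 / (1 - d ^ 2)) - -(1 / (1 - (τ * d) ^ 2) * τ) * τ)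
    (by fun_prop) ?_ ?_ ?_ <;> rw [interior_Icc] <;> intro d hd
  · have hlin : HasDerivAt (fun d : ℝ => τ * d) τ d := by
      simpa using (hasDerivAt_id d).const_mul τ
    exact (((hasDerivAt_signEntropy hd).const_mul _).sub
      ((hasDerivAt_signEntropy (mul_mem_Ioo hτ hd)).comp d hlin)).hasDerivWithinAt
  · have hlin : HasDerivAt (fun d : ℝ => τ * d) τ d := by
      simpa using (hasDerivAt_id d).const_mul τ
    exact (((hasDerivAt_artanh hd).neg.const_mul _).sub
      (((hasDerivAt_artanh (mul_mem_Ioo hτ hd)).comp d hlin).neg.mul_const τ)).hasDerivWithinAt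
  · have hτ1 : τ ^ 2 ≤ 1 := (sq_le_one_iff_abs_le_one τ).2 (abs_le.2 hτ)
    have hle : 1 / (1 - (τ * d) ^ 2) ≤ 1 / (1 - d ^ 2) :=
      one_div_le_one_div_of_le (one_sub_sq_pos hd) (by nlinarith [sq_nonneg d])
    nlinarith [mul_le_mul_of_nonneg_left hle (sq_nonneg τ)]

lemma concaveOn_signEntropy_add_sq :
    ConcaveOn ℝ (Icc (-1) 1) (fun d => signEntropy d + d ^ 2 / 2) := by
  refine concaveOn_of_hasDerivWithinAt2_nonpos (convex_Icc _ _) (f' := fun d => -artanh d + d)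
    (f'' := fun d => -(1 / (1 - d ^ 2)) + 1) (by fun_prop) ?_ ?_ ?_ <;>
    rw [interior_Icc] <;> intro d hd
  · exact ((hasDerivAt_signEntropy hd).add
      (((hasDerivAt_pow 2 d).div_const 2).congr_deriv (by simp))).hasDerivWithinAt
  · exact ((hasDerivAt_artanh hd).neg.add (hasDerivAt_id d)).hasDerivWithinAt
  · have : 1 ≤ 1 / (1 - d ^ 2) :=
      one_le_one_div (one_sub_sq_pos hd) (by nlinarith [sq_nonneg d])
    linarith

lemma signEntropy_le_log_two (d : ℝ) : signEntropy d ≤ log 2 := binEntropy_le_log_two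

lemma antitoneOn_signEntropy : AntitoneOn signEntropy (Icc 0 1) := by
  intro x hx y hy hxy
  refine (binEntropy_strictMonoOn.monotoneOn ?_ ?_ (by linarith : (1 - y) / 2 ≤ (1 - x) / 2)) <;>
    constructor <;> linarith [hx.1, hx.2, hy.1, hy.2]

lemma signEntropy_le_signEntropy_mul {τ d : ℝ} (hτ : τ ∈ Icc (-1 : ℝ) 1)
    (hd : d ∈ Icc (-1 : ℝ) 1) : signEntropy d ≤ signEntropy (τ * d) := by
  have hle : |τ * d| ≤ |d| := by
    rw [abs_mul]
    exact mul_le_of_le_one_left (abs_nonneg d) (abs_le.2 hτ)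
  rw [← signEntropy_abs d, ← signEntropy_abs (τ * d)]
  exact antitoneOn_signEntropy ⟨abs_nonneg _, hle.trans (abs_le.2 hd)⟩
    ⟨abs_nonneg _, abs_le.2 hd⟩ hle

lemma monotoneOn_artanh_div_self : MonotoneOn (fun x => artanh x / x) (Ioo 0 1) := by
  have hseries (z : ℝ) (hz : z ∈ Ioo (0 : ℝ) 1) :
      HasSum (fun k : ℕ => 1 / (2 * (k : ℝ) + 1) * z ^ (2 * k)) (artanh z / z) := by
    have hz' : z ∈ Ioo (-1 : ℝ) 1 := ⟨by linarith [hz.1], hz.2⟩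
    have hz0 : z ≠ 0 := hz.1.ne'
    have hlog : artanh z / z = (log (1 + z) - log (1 - z)) / (2 * z) := by
      rw [artanh_eq_half_log (Ioo_subset_Icc_self hz'),
        log_div (by linarith [hz.1]) (by linarith [hz.2])]
      ring
    have hterm (k : ℕ) : 1 / (2 * (k : ℝ) + 1) * z ^ (2 * k) =
        2 * (1 / (2 * (k : ℝ) + 1)) * z ^ (2 * k + 1) / (2 * z) := by
      rw [pow_succ]
      field_simp
    simp only [hlog, hterm]
    exact (hasSum_log_sub_log_of_abs_lt_one (abs_lt.2 hz')).div_const (2 * z)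
  intro x hx y hy hxy
  refine hasSum_le (fun k => ?_) (hseries x hx) (hseries y hy)
  have := hx.1.le
  gcongr

lemma concaveOn_signEntropy_sqrt : ConcaveOn ℝ (Icc 0 1) (fun w => signEntropy (√w)) := by
  have hsqrt {w : ℝ} (hw : w ∈ Ioo (0 : ℝ) 1) : √w ∈ Ioo (0 : ℝ) 1 :=
    ⟨sqrt_pos.2 hw.1, by rw [sqrt_lt' one_pos]; simpa using hw.2⟩
  have hderiv {w : ℝ} (hw : w ∈ Ioo (0 : ℝ) 1) :
      HasDerivAt (fun w => signEntropy (√w)) (-(artanh (√w) / √w) / 2) w := by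
    have h := hsqrt hw
    refine ((hasDerivAt_signEntropy ⟨by linarith [h.1], h.2⟩).comp w
      (hasDerivAt_sqrt hw.1.ne')).congr_deriv ?_
    have := h.1.ne'
    field_simp
  refine AntitoneOn.concaveOn_of_deriv (convex_Icc _ _) (by fun_prop) ?_ ?_ <;> rw [interior_Icc]
  · exact fun w hw => (hderiv hw).differentiableAt.differentiableWithinAt
  · intro v hv w hw hvw
    rw [(hderiv hv).deriv, (hderiv hw).deriv]
    have := monotoneOn_artanh_div_self (hsqrt hv) (hsqrt hw) (sqrt_le_sqrt hvw)
    linarith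

lemma hb_eq_binEntropy (p : ℝ) : hb p = binEntropy p / log 2 := by
  rw [binEntropy_eq_negMulLog_add_negMulLog_one_sub, hb, logb, logb, negMulLog, negMulLog]
  ring

lemma strictMonoOn_hb : StrictMonoOn hb (Icc 0 (1 / 2)) := by
  intro x hx y hy hxy
  rw [one_div] at hx hy
  rw [hb_eq_binEntropy, hb_eq_binEntropy]
  exact div_lt_div_of_pos_right (binEntropy_strictMonoOn hx hy hxy) (log_pos one_lt_two)

lemma surjOn_hb : SurjOn hb (Icc 0 (1 / 2)) (Icc 0 1) := by
  have hcont : Continuous hb := by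
    rw [show hb = fun p => binEntropy p / log 2 from funext hb_eq_binEntropy]
    fun_prop
  have h := intermediate_value_Icc (by norm_num : (0 : ℝ) ≤ 1 / 2) hcont.continuousOn
  have hzero : hb 0 = 0 := by simp [hb_eq_binEntropy]
  have hhalf : hb (1 / 2) = 1 := by
    rw [hb_eq_binEntropy, one_div, binEntropy_two_inv, div_self (log_pos one_lt_two).ne']
  rwa [hzero, hhalf] at h

lemma hbInv_mem {u : ℝ} (hu : u ∈ Icc (0 : ℝ) 1) : hbInv u ∈ Icc (0 : ℝ) (1 / 2) :=
  invFunOn_mem (surjOn_hb hu)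

lemma hb_hbInv {u : ℝ} (hu : u ∈ Icc (0 : ℝ) 1) : hb (hbInv u) = u :=
  invFunOn_eq (surjOn_hb hu)

lemma hbInv_hb {p : ℝ} (hp : p ∈ Icc (0 : ℝ) (1 / 2)) : hbInv (hb p) = p :=
  strictMonoOn_hb.injOn.leftInvOn_invFunOn hp

lemma strictMonoOn_hbInv : StrictMonoOn hbInv (Icc 0 1) := by
  intro u hu v hv huv
  rwa [← strictMonoOn_hb.lt_iff_lt (hbInv_mem hu) (hbInv_mem hv), hb_hbInv hu, hb_hbInv hv]

lemma strictMonoOn_psi : StrictMonoOn psi (Icc 0 1) := by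
  intro u hu v hv huv
  have hlt := strictMonoOn_hbInv hu hv huv
  have := (hbInv_mem hu).1
  have := (hbInv_mem hv).2
  simp only [psi]
  nlinarith

lemma psi_nonneg {u : ℝ} (hu : u ∈ Icc (0 : ℝ) 1) : 0 ≤ psi u := by
  have h := hbInv_mem hu
  simp only [psi]
  nlinarith [h.1, h.2]

lemma psi_signEntropy_sqrt {m : ℝ} (hm : m ∈ Icc (0 : ℝ) 1) :
    psi (signEntropy (√(1 - m)) / log 2) = m := by
  have hnonneg := sqrt_nonneg (1 - m)
  have hle : √(1 - m) ≤ 1 := by rw [sqrt_le_one]; linarith [hm.1]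
  rw [signEntropy, ← hb_eq_binEntropy, psi, hbInv_hb ⟨by linarith, by linarith⟩,
    show 1 - 2 * ((1 - √(1 - m)) / 2) = √(1 - m) by ring, sq_sqrt (by linarith [hm.2])]
  ring

/-! ### Laws of biases -/

/-- The interval `[-1,1]` of possible posterior means ("biases") of a `±1`-valued symbol. -/
abbrev Bias : Type := Icc (-1 : ℝ) 1

/-- The reflection `d ↦ -d` of the interval of biases, induced by flipping the symbol. -/
def Bias.reflect (d : Bias) : Bias := ⟨-d, neg_le_neg d.2.2, neg_le.1 d.2.1⟩

@[fun_prop]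
lemma Bias.continuous_reflect : Continuous Bias.reflect :=
  continuous_subtype_val.neg.subtype_mk _

/-- A law of biases that is invariant under flipping the symbol. -/
def IsSymmetricLaw (m : Measure Bias) : Prop := MeasurePreserving Bias.reflect m m

/-- The convex order on laws of biases: `m` is more spread out, hence more informative,
than `m'`. -/
def ConvexDominates (m m' : Measure Bias) : Prop :=
  ∀ f : ℝ → ℝ, ConcaveOn ℝ (Icc (-1) 1) f → ContinuousOn f (Icc (-1) 1) →
    ∫ d, f (d : ℝ) ∂m ≤ ∫ d, f (d : ℝ) ∂m'

/-- Conditional entropy, in nats, of a uniform symbol given an observation whose bias has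
law `m`. -/
noncomputable def meanEntropy (m : Measure Bias) : ℝ := ∫ d : Bias, signEntropy d ∂m

/-- Mutual information, in nats, between a symbol with mean `τ` and an observation whose bias
has law `m` when the symbol is uniform. -/
noncomputable def symbolInfo (m : Measure Bias) (τ : ℝ) : ℝ :=
  ∫ d : Bias, signEntropy (τ * d) ∂m - meanEntropy m

lemma integrable_of_continuous {X : Type*} [TopologicalSpace X] [CompactSpace X]
    [MeasurableSpace X] [OpensMeasurableSpace X] (μ : Measure X) [IsFiniteMeasureOnCompacts μ]
    {f : X → ℝ} (hf : Continuous f) : Integrable f μ :=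
  hf.integrable_of_hasCompactSupport (HasCompactSupport.of_compactSpace f)

section SymmetricLaw

variable {m : Measure Bias}

lemma IsSymmetricLaw.integral_reflect (hm : IsSymmetricLaw m) {f : ℝ → ℝ} (hf : Continuous f) :
    ∫ d : Bias, f (-d) ∂m = ∫ d : Bias, f d ∂m := by
  have hcont : Continuous fun d : Bias => f d := by fun_prop
  conv_rhs => rw [← hm.map_eq,
    integral_map hm.measurable.aemeasurable hcont.aestronglyMeasurable]
  rfl

lemma IsSymmetricLaw.integral_coe (hm : IsSymmetricLaw m) : ∫ d : Bias, (d : ℝ) ∂m = 0 := by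
  have h := hm.integral_reflect continuous_id
  simp only [id, integral_neg] at h
  linarith

variable [IsProbabilityMeasure m]

lemma IsSymmetricLaw.integral_negMulLog_one_add_mul (hm : IsSymmetricLaw m) (τ : ℝ) :
    ∫ d : Bias, negMulLog (1 + τ * d) ∂m = ∫ d : Bias, signEntropy (τ * d) ∂m - log 2 := by
  have hreflect : ∫ d : Bias, negMulLog (1 - τ * d) ∂m = ∫ d : Bias, negMulLog (1 + τ * d) ∂m := by
    rw [← hm.integral_reflect (f := fun d => negMulLog (1 + τ * d)) (by fun_prop)]
    simp only [mul_neg, sub_eq_add_neg]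
  simp only [signEntropy_eq_negMulLog]
  rw [integral_add (integrable_const _) (integrable_of_continuous m (by fun_prop)),
    integral_div, integral_add (integrable_of_continuous m (by fun_prop))
      (integrable_of_continuous m (by fun_prop)), hreflect, integral_const, probReal_univ]
  ring

lemma IsSymmetricLaw.integral_negMulLog_mul_one_add_mul (hm : IsSymmetricLaw m) (a τ : ℝ) :
    ∫ d : Bias, negMulLog (a * (1 + τ * d)) ∂m =
      negMulLog a + a * (∫ d : Bias, signEntropy (τ * d) ∂m - log 2) := by
  have hlin : ∫ d : Bias, (1 + τ * d) ∂m = 1 := by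
    rw [integral_add (integrable_const _) (integrable_of_continuous m (by fun_prop)),
      integral_const_mul, hm.integral_coe, integral_const, probReal_univ]
    ring
  simp only [negMulLog_mul]
  rw [integral_add (integrable_of_continuous m (by fun_prop))
      (integrable_of_continuous m (by fun_prop)), integral_mul_const, hlin, one_mul,
    integral_const_mul, hm.integral_negMulLog_one_add_mul]

end SymmetricLaw

lemma ConvexDominates.refl (m : Measure Bias) : ConvexDominates m m := fun _ _ _ => le_rfl

section SymbolInfo

variable {m m' : Measure Bias}

lemma ConvexDominates.meanEntropy_le (h : ConvexDominates m m') :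
    meanEntropy m ≤ meanEntropy m' :=
  h _ concaveOn_signEntropy continuous_signEntropy.continuousOn

lemma ConvexDominates.symbolInfo_sub_le (h : ConvexDominates m m') {τ : ℝ}
    (hτ : τ ∈ Icc (-1 : ℝ) 1) :
    symbolInfo m τ - symbolInfo m' τ ≤ meanEntropy m' - meanEntropy m := by
  have := h _ (concaveOn_signEntropy_mul hτ) (Continuous.continuousOn (by fun_prop))
  simp only [symbolInfo]
  linarith

lemma symbolInfo_zero [IsProbabilityMeasure m] : symbolInfo m 0 = log 2 - meanEntropy m := by
  simp [symbolInfo]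

lemma symbolInfo_nonneg [IsFiniteMeasure m] {τ : ℝ} (hτ : τ ∈ Icc (-1 : ℝ) 1) :
    0 ≤ symbolInfo m τ :=
  sub_nonneg.2 (integral_mono (integrable_of_continuous m (by fun_prop))
    (integrable_of_continuous m (by fun_prop)) fun d => signEntropy_le_signEntropy_mul hτ d.2)

lemma symbolInfo_le [IsProbabilityMeasure m] (τ : ℝ) :
    symbolInfo m τ ≤ log 2 - meanEntropy m := by
  have h : ∫ d : Bias, signEntropy (τ * d) ∂m ≤ ∫ _ : Bias, log 2 ∂m :=
    integral_mono (integrable_of_continuous m (by fun_prop)) (integrable_const _)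
      fun d => signEntropy_le_log_two _
  rw [integral_const, probReal_univ, one_smul] at h
  exact sub_le_sub_right h _

lemma ConvexDominates.le_symbolInfo_sub [IsFiniteMeasure m] [IsFiniteMeasure m']
    (h : ConvexDominates m m') {τ : ℝ} (hτ : τ ∈ Icc (-1 : ℝ) 1) :
    (1 - τ ^ 2) * (meanEntropy m' - meanEntropy m) ≤ symbolInfo m τ - symbolInfo m' τ := by
  have hconc := h _ (concaveOn_sq_mul_signEntropy_sub hτ) (Continuous.continuousOn (by fun_prop))
  have hsplit (ρ : Measure Bias) [IsFiniteMeasure ρ] :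
      ∫ d : Bias, (τ ^ 2 * signEntropy d - signEntropy (τ * d)) ∂ρ =
        τ ^ 2 * meanEntropy ρ - ∫ d : Bias, signEntropy (τ * d) ∂ρ := by
    rw [integral_sub (integrable_of_continuous ρ (by fun_prop))
      (integrable_of_continuous ρ (by fun_prop)), integral_const_mul, meanEntropy]
  rw [hsplit, hsplit] at hconc
  simp only [symbolInfo]
  linarith

lemma symbolInfo_of_perfect [IsProbabilityMeasure m] (hm : ∀ᵐ d : Bias ∂m, |(d : ℝ)| = 1)
    (τ : ℝ) : symbolInfo m τ = signEntropy τ := by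
  have hmul (σ : ℝ) : ∫ d : Bias, signEntropy (σ * d) ∂m = signEntropy σ := by
    have h : (fun d : Bias => signEntropy (σ * d)) =ᵐ[m] fun _ => signEntropy σ := by
      filter_upwards [hm] with d hd
      rw [← signEntropy_abs, abs_mul, hd, mul_one, signEntropy_abs]
    rw [integral_congr_ae h, integral_const, probReal_univ, one_smul]
  have hone := hmul 1
  simp only [one_mul, signEntropy_one] at hone
  rw [symbolInfo, meanEntropy, hmul, hone, sub_zero]

end SymbolInfo

section Update

variable {ι : Type*} [DecidableEq ι] {E : ι → Type*} [∀ j, MeasurableSpace (E j)]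

lemma isProbabilityMeasure_update (θ : ∀ j, Measure (E j)) [hθ : ∀ j, IsProbabilityMeasure (θ j)]
    (i : ι) (m : Measure (E i)) [IsProbabilityMeasure m] (j : ι) :
    IsProbabilityMeasure (update θ i m j) := by
  rcases eq_or_ne j i with rfl | hj
  · rwa [update_self]
  · rw [update_of_ne hj]; exact hθ j

variable [Fintype ι] (θ : ∀ j, Measure (E j)) [∀ j, IsProbabilityMeasure (θ j)] (i : ι)
  (m : Measure (E i)) [IsProbabilityMeasure m]

lemma measurePreserving_update :
    MeasurePreserving (fun q : (∀ j, E j) × E i => update q.1 i q.2)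
      ((Measure.pi θ).prod m) (Measure.pi (update θ i m)) := by
  have := isProbabilityMeasure_update θ i m
  refine ⟨measurable_update', Eq.symm (Measure.pi_eq fun s hs => ?_)⟩
  have hpreimage : (fun q : (∀ j, E j) × E i => update q.1 i q.2) ⁻¹' univ.pi s =
      univ.pi (update s i univ) ×ˢ s i := by
    ext q
    simp only [mem_preimage, mem_univ_pi, mem_prod,
      forall_update_iff q.1 (fun j e => e ∈ s j), forall_update_iff s (fun j t => q.1 j ∈ t),
      mem_univ, true_and]
    exact and_comm
  rw [Measure.map_apply measurable_update' (MeasurableSet.univ_pi hs), hpreimage,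
    Measure.prod_prod, Measure.pi_pi, ← Finset.prod_erase_mul _ _ (Finset.mem_univ i),
    ← Finset.prod_erase_mul _ _ (Finset.mem_univ i)]
  simp only [update_self, measure_univ, mul_one]
  congr 1
  refine Finset.prod_congr rfl fun j hj => ?_
  rw [update_of_ne (Finset.ne_of_mem_erase hj), update_of_ne (Finset.ne_of_mem_erase hj)]

variable [∀ j, TopologicalSpace (E j)] [∀ j, CompactSpace (E j)]
  [∀ j, SecondCountableTopology (E j)] [∀ j, BorelSpace (E j)] {G : (∀ j, E j) → ℝ}

lemma integrable_update (hG : Continuous G) :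
    Integrable (fun q : (∀ j, E j) × E i => G (update q.1 i q.2)) ((Measure.pi θ).prod m) :=
  integrable_of_continuous _ (hG.comp (continuous_fst.update i continuous_snd))

lemma integral_pi_update (hG : Continuous G) :
    ∫ d, G d ∂Measure.pi (update θ i m) = ∫ d, ∫ u, G (update d i u) ∂m ∂Measure.pi θ := by
  rw [← (measurePreserving_update θ i m).map_eq,
    integral_map (measurePreserving_update θ i m).measurable.aemeasurable
      hG.aestronglyMeasurable, integral_prod _ (integrable_update θ i m hG)]

end Update

/-! ### Posterior of a word given biases -/

lemma abs_bpsk (b : Bool) : |bpsk b| = 1 := by cases b <;> simp [bpsk]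

lemma bpsk_sq (b : Bool) : bpsk b ^ 2 = 1 := by rw [← sq_abs, abs_bpsk, one_pow]

lemma signEntropy_bpsk_mul (b : Bool) (d : ℝ) : signEntropy (bpsk b * d) = signEntropy d := by
  rw [← signEntropy_abs, abs_mul, abs_bpsk, one_mul, signEntropy_abs]

lemma one_add_bpsk_mul_nonneg (b : Bool) (d : Bias) : 0 ≤ 1 + bpsk b * d := by
  have h : |bpsk b * d| ≤ 1 := by
    rw [abs_mul, abs_bpsk, one_mul]
    exact abs_le.2 d.2
  linarith [(abs_le.1 h).1]

section Likelihood

variable {ι : Type*}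

/-- Likelihood of the word `x` when the biases observed at the positions in `s` are `d`, relative
to a product law of the biases. -/
noncomputable def likelihood (s : Finset ι) (x : ι → Bool) (d : ι → Bias) : ℝ :=
  ∏ j ∈ s, (1 + bpsk (x j) * d j)

lemma likelihood_nonneg (s : Finset ι) (x : ι → Bool) (d : ι → Bias) : 0 ≤ likelihood s x d :=
  Finset.prod_nonneg fun j _ => one_add_bpsk_mul_nonneg (x j) (d j)

@[fun_prop]
lemma continuous_likelihood (s : Finset ι) (x : ι → Bool) : Continuous (likelihood s x) := by
  unfold likelihood; fun_prop

lemma likelihood_update_of_mem [DecidableEq ι] {s : Finset ι} {i : ι} (hi : i ∈ s) (x : ι → Bool)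
    (d : ι → Bias) (u : Bias) :
    likelihood s x (update d i u) = likelihood (s.erase i) x d * (1 + bpsk (x i) * u) := by
  rw [likelihood, ← Finset.prod_erase_mul _ _ hi, update_self]
  congr 1
  exact Finset.prod_congr rfl fun j hj => by rw [update_of_ne (Finset.ne_of_mem_erase hj)]

lemma likelihood_update_of_notMem [DecidableEq ι] {s : Finset ι} {i : ι} (hi : i ∉ s)
    (x : ι → Bool) (d : ι → Bias) (u : Bias) :
    likelihood s x (update d i u) = likelihood s x d :=
  Finset.prod_congr rfl fun j hj => by rw [update_of_ne (ne_of_mem_of_not_mem hj hi)]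

variable [Fintype ι]

lemma integral_likelihood (s : Finset ι) (x : ι → Bool) (θ : ι → Measure Bias)
    [∀ j, IsProbabilityMeasure (θ j)] (hθ : ∀ j, IsSymmetricLaw (θ j)) :
    ∫ d, likelihood s x d ∂Measure.pi θ = 1 := by
  classical
  have hprod (d : ι → Bias) : likelihood s x d =
      ∏ j, (if j ∈ s then 1 + bpsk (x j) * (d j : ℝ) else 1) := by
    rw [Finset.prod_ite_mem, Finset.univ_inter, likelihood]
  simp only [hprod]
  rw [integral_fintype_prod_eq_prod (f := fun j (u : Bias) =>
    if j ∈ s then 1 + bpsk (x j) * (u : ℝ) else 1)]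
  refine Finset.prod_eq_one fun j _ => ?_
  split_ifs
  · rw [integral_add (integrable_const _) (integrable_of_continuous _ (by fun_prop)),
      integral_const_mul, (hθ j).integral_coe, mul_zero, add_zero, integral_const, probReal_univ,
      one_smul]
  · rw [integral_const, probReal_univ, one_smul]

end Likelihood

section Posterior

variable {ι : Type*} [Fintype ι] [DecidableEq ι] (μ : Measure (ι → Bool)) (s : Finset ι) (i : ι)

/-- Density of the biases observed at the positions in `s` when the word has law `μ`. -/
noncomputable def evidence (d : ι → Bias) : ℝ := ∑ x, μ.real {x} * likelihood s x d

/-- Posterior mean of the symbol `i`, multiplied by the density of the observation. -/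
noncomputable def evidenceMean (d : ι → Bias) : ℝ :=
  ∑ x, μ.real {x} * likelihood s x d * bpsk (x i)

/-- Posterior mean of the symbol `i` given the biases observed at the positions in `s`, for a word
with law `μ`. It is `0` where the density of the observation vanishes. -/
noncomputable def postMean (d : ι → Bias) : ℝ := evidenceMean μ s i d / evidence μ s d

/-- Posterior variance of the symbol `i`, multiplied by the density of the observation. -/
noncomputable def errDensity (d : ι → Bias) : ℝ := evidence μ s d * (1 - postMean μ s i d ^ 2)

/-- Posterior entropy, in nats, of the word, multiplied by the density of the observation. -/
noncomputable def entDensity (d : ι → Bias) : ℝ :=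
  ∑ x, negMulLog (μ.real {x} * likelihood s x d) - negMulLog (evidence μ s d)

@[fun_prop]
lemma continuous_evidence : Continuous (evidence μ s) := by unfold evidence; fun_prop

@[fun_prop]
lemma continuous_evidenceMean : Continuous (evidenceMean μ s i) := by
  unfold evidenceMean; fun_prop

@[fun_prop]
lemma continuous_entDensity : Continuous (entDensity μ s) := by unfold entDensity; fun_prop

@[fun_prop]
lemma measurable_postMean : Measurable (postMean μ s i) :=
  (continuous_evidenceMean μ s i).measurable.div (continuous_evidence μ s).measurable

lemma evidence_nonneg (d : ι → Bias) : 0 ≤ evidence μ s d :=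
  Finset.sum_nonneg fun x _ => mul_nonneg measureReal_nonneg (likelihood_nonneg s x d)

lemma abs_evidenceMean_le (d : ι → Bias) : |evidenceMean μ s i d| ≤ evidence μ s d := by
  refine (Finset.abs_sum_le_sum_abs _ _).trans_eq (Finset.sum_congr rfl fun x _ => ?_)
  rw [abs_mul, abs_bpsk, mul_one,
    abs_of_nonneg (mul_nonneg measureReal_nonneg (likelihood_nonneg s x d))]

lemma postMean_mem (d : ι → Bias) : postMean μ s i d ∈ Icc (-1 : ℝ) 1 := by
  rw [mem_Icc, ← abs_le, postMean, abs_div, abs_of_nonneg (evidence_nonneg μ s d)]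
  exact div_le_one_of_le₀ (abs_evidenceMean_le μ s i d) (evidence_nonneg μ s d)

lemma postMean_sq_mem (d : ι → Bias) : postMean μ s i d ^ 2 ∈ Icc (0 : ℝ) 1 :=
  ⟨sq_nonneg _, (sq_le_one_iff_abs_le_one _).2 (abs_le.2 (postMean_mem μ s i d))⟩

lemma evidence_mul_postMean (d : ι → Bias) :
    evidence μ s d * postMean μ s i d = evidenceMean μ s i d := by
  refine mul_div_cancel_of_imp' fun h => ?_
  exact abs_nonpos_iff.1 (h ▸ abs_evidenceMean_le μ s i d)

lemma errDensity_nonneg (d : ι → Bias) : 0 ≤ errDensity μ s i d :=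
  mul_nonneg (evidence_nonneg μ s d) (sub_nonneg.2 (postMean_sq_mem μ s i d).2)

lemma errDensity_le_evidence (d : ι → Bias) : errDensity μ s i d ≤ evidence μ s d :=
  mul_le_of_le_one_right (evidence_nonneg μ s d) (sub_le_self _ (sq_nonneg _))

lemma continuous_errDensity : Continuous (errDensity μ s i) := by
  refine continuous_iff_continuousAt.2 fun d => ?_
  by_cases h : evidence μ s d = 0
  · rw [ContinuousAt, show errDensity μ s i d = 0 by rw [errDensity, h, zero_mul]]
    exact squeeze_zero (errDensity_nonneg μ s i) (errDensity_le_evidence μ s i)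
      (h ▸ (continuous_evidence μ s).tendsto d)
  · have hev := (continuous_evidence μ s).continuousAt (x := d)
    exact hev.mul (continuousAt_const.sub
      (((continuous_evidenceMean μ s i).continuousAt.div hev h).pow 2))

lemma errDensity_le (d : ι → Bias) (c : ℝ) :
    errDensity μ s i d ≤ (1 + c ^ 2) * evidence μ s d - 2 * c * evidenceMean μ s i d := by
  rw [errDensity, ← evidence_mul_postMean]
  nlinarith [mul_nonneg (evidence_nonneg μ s d) (sq_nonneg (postMean μ s i d - c))]

lemma errDensity_eq_postMean (d : ι → Bias) :
    errDensity μ s i d = (1 + postMean μ s i d ^ 2) * evidence μ s d -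
      2 * postMean μ s i d * evidenceMean μ s i d := by
  rw [errDensity, ← evidence_mul_postMean]
  ring

section Update

variable {s}

lemma evidence_update_of_mem {j : ι} (hj : j ∈ s) (d : ι → Bias) (u : Bias) :
    evidence μ s (update d j u) =
      evidence μ (s.erase j) d + evidenceMean μ (s.erase j) j d * u := by
  simp only [evidence, evidenceMean, likelihood_update_of_mem hj, Finset.sum_mul,
    ← Finset.sum_add_distrib]
  exact Finset.sum_congr rfl fun x _ => by ring

lemma evidenceMean_update_of_mem {j : ι} (hj : j ∈ s) (d : ι → Bias) (u : Bias) :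
    evidenceMean μ s i (update d j u) = evidenceMean μ (s.erase j) i d +
      (∑ x, μ.real {x} * likelihood (s.erase j) x d * bpsk (x i) * bpsk (x j)) * u := by
  simp only [evidenceMean, likelihood_update_of_mem hj, Finset.sum_mul, ← Finset.sum_add_distrib]
  exact Finset.sum_congr rfl fun x _ => by ring

lemma errDensity_update_of_notMem {j : ι} (hj : j ∉ s) (d : ι → Bias) (u : Bias) :
    errDensity μ s i (update d j u) = errDensity μ s i d := by
  simp only [errDensity, postMean, evidence, evidenceMean, likelihood_update_of_notMem hj]

/-- As a minimum of functions that are affine in `u`, the error density is concave. -/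
lemma concaveOn_errDensity_update {j : ι} (hj : j ∈ s) (d : ι → Bias) :
    ConcaveOn ℝ (Icc (-1) 1) (IccExtend (by norm_num : (-1 : ℝ) ≤ 1)
      fun u : Bias => errDensity μ s i (update d j u)) := by
  refine ⟨convex_Icc _ _, fun u hu v hv a b ha hb hab => ?_⟩
  have hw := convex_Icc (-1 : ℝ) 1 hu hv ha hb hab
  rw [IccExtend_of_mem _ _ hu, IccExtend_of_mem _ _ hv, IccExtend_of_mem _ _ hw,
    errDensity_eq_postMean μ s i (update d j ⟨a • u + b • v, hw⟩)]
  set c := postMean μ s i (update d j ⟨a • u + b • v, hw⟩)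
  have hleu := mul_le_mul_of_nonneg_left (errDensity_le μ s i (update d j ⟨u, hu⟩) c) ha
  have hlev := mul_le_mul_of_nonneg_left (errDensity_le μ s i (update d j ⟨v, hv⟩) c) hb
  simp only [evidence_update_of_mem μ hj, evidenceMean_update_of_mem μ i hj, smul_eq_mul]
    at hleu hlev ⊢
  refine (add_le_add hleu hlev).trans_eq ?_
  linear_combination ((1 + c ^ 2) * evidence μ (s.erase j) d -
    2 * c * evidenceMean μ (s.erase j) i d) * hab

lemma integral_errDensity_update_le {m m' : Measure Bias} [IsProbabilityMeasure m]
    [IsProbabilityMeasure m'] (h : ConvexDominates m m') (j : ι) (d : ι → Bias) :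
    ∫ u, errDensity μ s i (update d j u) ∂m ≤ ∫ u, errDensity μ s i (update d j u) ∂m' := by
  by_cases hj : j ∈ s
  · have hcont : Continuous fun u => errDensity μ s i (update d j u) :=
      (continuous_errDensity μ s i).comp (continuous_const.update j continuous_id)
    simpa only [IccExtend_val] using
      h _ (concaveOn_errDensity_update μ i hj d) hcont.Icc_extend'.continuousOn
  · simp only [errDensity_update_of_notMem μ i hj, integral_const, probReal_univ, le_refl]

/-- The chain rule `H(X | Y_s) = H(X | Y_{s \ i}) - I(X_i; Y_i | Y_{s \ i})`, before averaging over
the observation `Y_{s \ i}`. -/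
lemma integral_entDensity_update {m : Measure Bias} [IsProbabilityMeasure m]
    (hm : IsSymmetricLaw m) {i : ι} (hi : i ∈ s) (d : ι → Bias) :
    ∫ u, entDensity μ s (update d i u) ∂m = entDensity μ (s.erase i) d -
      evidence μ (s.erase i) d * symbolInfo m (postMean μ (s.erase i) i d) := by
  have hword (x : ι → Bool) (u : Bias) : μ.real {x} * likelihood s x (update d i u) =
      μ.real {x} * likelihood (s.erase i) x d * (1 + bpsk (x i) * u) := by
    rw [likelihood_update_of_mem hi, mul_assoc]
  have htotal (u : Bias) : evidence μ s (update d i u) =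
      evidence μ (s.erase i) d * (1 + postMean μ (s.erase i) i d * u) := by
    rw [evidence_update_of_mem μ hi, ← evidence_mul_postMean]
    ring
  simp only [entDensity, hword, htotal]
  rw [integral_sub (integrable_of_continuous m (by fun_prop))
      (integrable_of_continuous m (by fun_prop)),
    integral_finsetSum _ fun x _ => integrable_of_continuous m (by fun_prop)]
  simp only [hm.integral_negMulLog_mul_one_add_mul, signEntropy_bpsk_mul, Finset.sum_add_distrib,
    ← Finset.sum_mul]
  rw [symbolInfo, meanEntropy, evidence]
  ring

end Update

end Posterior

/-! ### Changing the channel at one position -/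

lemma integral_withDensity_ofReal {X : Type*} [MeasurableSpace X] {P : Measure X} {q : X → ℝ}
    (hq : Measurable q) (hq0 : ∀ x, 0 ≤ q x) (g : X → ℝ) :
    ∫ x, g x ∂P.withDensity (fun x => ENNReal.ofReal (q x)) = ∫ x, q x * g x ∂P := by
  rw [integral_withDensity_eq_integral_toReal_smul hq.ennreal_ofReal (by simp)]
  simp only [ENNReal.toReal_ofReal (hq0 _), smul_eq_mul]

lemma integrable_withDensity_ofReal {X : Type*} [MeasurableSpace X] {P : Measure X} {q : X → ℝ}
    (hq : Measurable q) (hq0 : ∀ x, 0 ≤ q x) {g : X → ℝ} :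
    Integrable g (P.withDensity fun x => ENNReal.ofReal (q x)) ↔
      Integrable (fun x => q x * g x) P := by
  rw [integrable_withDensity_iff_integrable_smul' hq.ennreal_ofReal (by simp)]
  simp only [ENNReal.toReal_ofReal (hq0 _), smul_eq_mul]

lemma integral_mul_comp_le_of_concaveOn {X : Type*} [MeasurableSpace X] {P : Measure X}
    {q f : X → ℝ} {φ : ℝ → ℝ} {s : Set ℝ} (hφ : ConcaveOn ℝ s φ) (hφc : ContinuousOn φ s)
    (hs : IsClosed s) (hq : Measurable q) (hq0 : ∀ x, 0 ≤ q x) (hqint : ∫ x, q x ∂P = 1)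
    (hf : ∀ x, f x ∈ s) (hfint : Integrable (fun x => q x * f x) P)
    (hφint : Integrable (fun x => q x * φ (f x)) P) :
    ∫ x, q x * φ (f x) ∂P ≤ φ (∫ x, q x * f x ∂P) := by
  have : IsProbabilityMeasure (P.withDensity fun x => ENNReal.ofReal (q x)) := ⟨by
    rw [withDensity_apply _ MeasurableSet.univ, Measure.restrict_univ,
      ← ofReal_integral_eq_lintegral_ofReal (.of_integral_ne_zero (by simp [hqint]))
        (ae_of_all _ hq0), hqint, ENNReal.ofReal_one]⟩
  simp only [← integral_withDensity_ofReal hq hq0]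
  exact hφ.le_map_integral hφc hs (ae_of_all _ hf) ((integrable_withDensity_ofReal hq hq0).2 hfint)
    ((integrable_withDensity_ofReal hq hq0).2 hφint)

section Block

variable {ι : Type*} [Fintype ι] [DecidableEq ι]

/-- Conditional entropy `H(X | Y)`, in nats, of a word with law `μ` when the law of the bias
observed at the position `j` for a uniform symbol is `θ j`. -/
noncomputable def blockEntropy (μ : Measure (ι → Bool)) (θ : ι → Measure Bias) : ℝ :=
  ∫ d, entDensity μ Finset.univ d ∂Measure.pi θ

/-- Extrinsic minimum mean-squared error of the symbol `i` of a word with law `μ`, for biases with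
laws `θ`. -/
noncomputable def blockMMSE (μ : Measure (ι → Bool)) (i : ι) (θ : ι → Measure Bias) : ℝ :=
  ∫ d, errDensity μ (Finset.univ.erase i) i d ∂Measure.pi θ

/-- Conditional mutual information `I(X_i ; Y_i | Y_{∼i})`, in nats, when the bias observed at the
position `i` has law `m` and the other ones have laws `θ`. -/
noncomputable def extrinsicInfo (μ : Measure (ι → Bool)) (i : ι) (θ : ι → Measure Bias)
    (m : Measure Bias) : ℝ :=
  ∫ d, evidence μ (Finset.univ.erase i) d * symbolInfo m (postMean μ (Finset.univ.erase i) i d)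
    ∂Measure.pi θ

variable (μ : Measure (ι → Bool)) (i : ι) (θ : ι → Measure Bias)
  [∀ j, IsProbabilityMeasure (θ j)] {m m' : Measure Bias} [IsProbabilityMeasure m]
  [IsProbabilityMeasure m']

lemma blockMMSE_nonneg (θ : ι → Measure Bias) : 0 ≤ blockMMSE μ i θ :=
  integral_nonneg (errDensity_nonneg μ _ i)

lemma blockMMSE_update_le (j : ι) (h : ConvexDominates m m') :
    blockMMSE μ i (update θ j m) ≤ blockMMSE μ i (update θ j m') := by
  have hcont := continuous_errDensity μ (Finset.univ.erase i) i
  rw [blockMMSE, blockMMSE, integral_pi_update θ j m hcont, integral_pi_update θ j m' hcont]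
  exact integral_mono (integrable_update θ j m hcont).integral_prod_left
    (integrable_update θ j m' hcont).integral_prod_left
    (integral_errDensity_update_le μ i h j)

lemma integrable_evidence_mul_symbolInfo (hm : IsSymmetricLaw m) :
    Integrable (fun d => evidence μ (Finset.univ.erase i) d *
      symbolInfo m (postMean μ (Finset.univ.erase i) i d)) (Measure.pi θ) := by
  have hent := continuous_entDensity μ (Finset.univ.erase i)
  have hupdate := (integrable_update θ i m (continuous_entDensity μ Finset.univ)).integral_prod_left
  simp only [integral_entDensity_update μ hm (Finset.mem_univ i)] at hupdate
  exact ((integrable_of_continuous (Measure.pi θ) hent).sub hupdate).congr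
    (ae_of_all _ fun d => sub_sub_cancel _ _)

lemma blockEntropy_update (hm : IsSymmetricLaw m) :
    blockEntropy μ (update θ i m) =
      ∫ d, entDensity μ (Finset.univ.erase i) d ∂Measure.pi θ - extrinsicInfo μ i θ m := by
  rw [blockEntropy, integral_pi_update θ i m (continuous_entDensity μ _)]
  simp only [integral_entDensity_update μ hm (Finset.mem_univ i)]
  rw [integral_sub (integrable_of_continuous _ (continuous_entDensity μ _))
    (integrable_evidence_mul_symbolInfo μ i θ hm), extrinsicInfo]

lemma extrinsicInfo_nonneg (θ : ι → Measure Bias) : 0 ≤ extrinsicInfo μ i θ m :=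
  integral_nonneg fun d => mul_nonneg (evidence_nonneg μ _ d)
    (symbolInfo_nonneg (postMean_mem μ _ i d))

lemma le_extrinsicInfo_sub (hm : IsSymmetricLaw m) (hm' : IsSymmetricLaw m')
    (h : ConvexDominates m m') :
    blockMMSE μ i θ * (meanEntropy m' - meanEntropy m) ≤
      extrinsicInfo μ i θ m - extrinsicInfo μ i θ m' := by
  have hint := integrable_evidence_mul_symbolInfo μ i θ hm
  have hint' := integrable_evidence_mul_symbolInfo μ i θ hm'
  rw [extrinsicInfo, extrinsicInfo, ← integral_sub hint hint', blockMMSE, ← integral_mul_const]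
  refine integral_mono ((integrable_of_continuous _ (continuous_errDensity μ _ i)).mul_const _)
    (hint.sub hint') fun d => ?_
  simp only [errDensity, ← mul_sub, mul_assoc]
  exact mul_le_mul_of_nonneg_left (h.le_symbolInfo_sub (postMean_mem μ _ i d))
    (evidence_nonneg μ _ d)

lemma le_blockEntropy_update_sub (hm : IsSymmetricLaw m) (hm' : IsSymmetricLaw m')
    (h : ConvexDominates m m') :
    blockMMSE μ i θ * (meanEntropy m' - meanEntropy m) ≤
      blockEntropy μ (update θ i m') - blockEntropy μ (update θ i m) := by
  rw [blockEntropy_update μ i θ hm, blockEntropy_update μ i θ hm', sub_sub_sub_cancel_left]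
  exact le_extrinsicInfo_sub μ i θ hm hm' h

variable [IsProbabilityMeasure μ] {θ}

lemma integral_evidence (s : Finset ι) (hθ : ∀ j, IsSymmetricLaw (θ j)) :
    ∫ d, evidence μ s d ∂Measure.pi θ = 1 := by
  simp only [evidence]
  rw [integral_finsetSum _ fun x _ => integrable_of_continuous _ (by fun_prop)]
  simp only [integral_const_mul, integral_likelihood s _ θ hθ, mul_one]
  rw [sum_measureReal_singleton, Finset.coe_univ, probReal_univ]

lemma integral_evidence_mul_postMean_sq (hθ : ∀ j, IsSymmetricLaw (θ j)) :
    ∫ d, evidence μ (Finset.univ.erase i) d * postMean μ (Finset.univ.erase i) i d ^ 2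
      ∂Measure.pi θ = 1 - blockMMSE μ i θ := by
  have hsub (d : ι → Bias) :
      evidence μ (Finset.univ.erase i) d * postMean μ (Finset.univ.erase i) i d ^ 2 =
        evidence μ (Finset.univ.erase i) d - errDensity μ (Finset.univ.erase i) i d := by
    rw [errDensity]; ring
  simp only [hsub]
  rw [integral_sub (integrable_of_continuous _ (by fun_prop))
    (integrable_of_continuous _ (continuous_errDensity μ _ i)), integral_evidence μ _ hθ, blockMMSE]

lemma blockMMSE_le_one (hθ : ∀ j, IsSymmetricLaw (θ j)) : blockMMSE μ i θ ≤ 1 := by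
  rw [← sub_nonneg, ← integral_evidence_mul_postMean_sq μ i hθ]
  exact integral_nonneg fun d => mul_nonneg (evidence_nonneg μ _ d) (sq_nonneg _)

lemma extrinsicInfo_sub_le (hθ : ∀ j, IsSymmetricLaw (θ j)) (hm : IsSymmetricLaw m)
    (hm' : IsSymmetricLaw m') (h : ConvexDominates m m') :
    extrinsicInfo μ i θ m - extrinsicInfo μ i θ m' ≤ meanEntropy m' - meanEntropy m := by
  have hint := integrable_evidence_mul_symbolInfo μ i θ hm
  have hint' := integrable_evidence_mul_symbolInfo μ i θ hm'
  have hmean : meanEntropy m' - meanEntropy m =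
      ∫ d, evidence μ (Finset.univ.erase i) d * (meanEntropy m' - meanEntropy m) ∂Measure.pi θ := by
    rw [integral_mul_const, integral_evidence μ _ hθ, one_mul]
  rw [extrinsicInfo, extrinsicInfo, ← integral_sub hint hint', hmean]
  refine integral_mono (hint.sub hint')
    ((integrable_of_continuous _ (continuous_evidence μ _)).mul_const _) fun d => ?_
  simp only [← mul_sub]
  exact mul_le_mul_of_nonneg_left (h.symbolInfo_sub_le (postMean_mem μ _ i d))
    (evidence_nonneg μ _ d)

/-- Over a perfect channel the mutual information is the entropy of the posterior mean, to which
Jensen's inequality applies since `signEntropy ∘ √` is concave. -/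
lemma extrinsicInfo_le_of_perfect (hθ : ∀ j, IsSymmetricLaw (θ j)) (hm : IsSymmetricLaw m)
    (hperfect : ∀ᵐ d : Bias ∂m, |(d : ℝ)| = 1) :
    extrinsicInfo μ i θ m ≤ signEntropy (√(1 - blockMMSE μ i θ)) := by
  have hsqrt (τ : ℝ) : symbolInfo m τ = signEntropy (√(τ ^ 2)) := by
    rw [symbolInfo_of_perfect hperfect, sqrt_sq_eq_abs, signEntropy_abs]
  have hint := integrable_evidence_mul_symbolInfo μ i θ hm
  simp only [hsqrt] at hint
  simp only [extrinsicInfo, hsqrt]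
  rw [← integral_evidence_mul_postMean_sq μ i hθ]
  refine integral_mul_comp_le_of_concaveOn concaveOn_signEntropy_sqrt
    (Continuous.continuousOn (by fun_prop)) isClosed_Icc (continuous_evidence μ _).measurable
    (evidence_nonneg μ _) (integral_evidence μ _ hθ) (postMean_sq_mem μ _ i) ?_ hint
  exact (integrable_of_continuous _ (continuous_evidence μ _)).mul_bdd (c := 1)
    (by fun_prop) (ae_of_all _ fun d => by
      rw [norm_eq_abs, abs_of_nonneg (sq_nonneg _)]; exact (postMean_sq_mem μ _ i d).2)

lemma blockEntropy_update_sub_le (hθ : ∀ j, IsSymmetricLaw (θ j)) (hm : IsSymmetricLaw m)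
    (hm' : IsSymmetricLaw m') (h : ConvexDominates m m') :
    blockEntropy μ (update θ i m') - blockEntropy μ (update θ i m) ≤
      meanEntropy m' - meanEntropy m := by
  rw [blockEntropy_update μ i θ hm, blockEntropy_update μ i θ hm', sub_sub_sub_cancel_left]
  exact extrinsicInfo_sub_le μ i hθ hm hm' h

lemma blockEntropy_update_sub_le_of_perfect (hθ : ∀ j, IsSymmetricLaw (θ j))
    (hm : IsSymmetricLaw m) (hm' : IsSymmetricLaw m') (hperfect : ∀ᵐ d : Bias ∂m, |(d : ℝ)| = 1) :
    blockEntropy μ (update θ i m') - blockEntropy μ (update θ i m) ≤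
      signEntropy (√(1 - blockMMSE μ i θ)) := by
  rw [blockEntropy_update μ i θ hm, blockEntropy_update μ i θ hm', sub_sub_sub_cancel_left]
  exact (sub_le_self _ (extrinsicInfo_nonneg μ i θ)).trans
    (extrinsicInfo_le_of_perfect μ i hθ hm hperfect)

end Block

/-! ### Changing the channel at all positions -/

lemma ae_pi_forall {ι : Type*} [Fintype ι] {E : ι → Type*} [∀ j, MeasurableSpace (E j)]
    {θ : ∀ j, Measure (E j)} [∀ j, SigmaFinite (θ j)] {P : ∀ j, E j → Prop}
    (h : ∀ j, ∀ᵐ u ∂θ j, P j u) : ∀ᵐ d ∂Measure.pi θ, ∀ j, P j (d j) :=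
  ae_all_iff.2 fun j => (Measure.quasiMeasurePreserving_eval θ j).ae (h j)

section Degrading

variable {ι : Type*} [DecidableEq ι] {θ θ' : ι → Measure Bias}

lemma isProbabilityMeasure_piecewise [hθ : ∀ j, IsProbabilityMeasure (θ j)]
    [hθ' : ∀ j, IsProbabilityMeasure (θ' j)] (A : Finset ι) (j : ι) :
    IsProbabilityMeasure (A.piecewise θ' θ j) :=
  A.piecewise_cases θ' θ _ (hθ' j) (hθ j)

lemma isSymmetricLaw_piecewise (hθ : ∀ j, IsSymmetricLaw (θ j)) (hθ' : ∀ j, IsSymmetricLaw (θ' j))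
    (A : Finset ι) (j : ι) : IsSymmetricLaw (A.piecewise θ' θ j) :=
  A.piecewise_cases θ' θ _ (hθ' j) (hθ j)

variable [Fintype ι]

/-- Telescoping: the coordinates of `θ` are replaced by those of `θ'` one at a time. -/
lemma le_add_sum_of_update_le {E : Type*} (F : (ι → E) → ℝ) (θ θ' : ι → E) (b : ι → ℝ)
    (h : ∀ (A : Finset ι) (i : ι), F (update (A.piecewise θ' θ) i (θ' i)) ≤
      F (update (A.piecewise θ' θ) i (θ i)) + b i) :
    F θ' ≤ F θ + ∑ i, b i := by
  suffices ∀ A : Finset ι, F (A.piecewise θ' θ) ≤ F θ + ∑ i ∈ A, b i by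
    simpa only [Finset.piecewise_univ] using this Finset.univ
  intro A
  induction A using Finset.induction_on with
  | empty => simp
  | insert i A hi ih =>
    have hself : update (A.piecewise θ' θ) i (θ i) = A.piecewise θ' θ := by
      rw [← Finset.piecewise_eq_of_notMem A θ' θ hi, update_eq_self]
    have hstep := h A i
    rw [hself] at hstep
    rw [Finset.piecewise_insert, Finset.sum_insert hi]
    linarith

variable (μ : Measure (ι → Bool)) [∀ j, IsProbabilityMeasure (θ j)]
  [∀ j, IsProbabilityMeasure (θ' j)]

lemma blockMMSE_mono (i : ι) (h : ∀ j, ConvexDominates (θ j) (θ' j)) :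
    blockMMSE μ i θ ≤ blockMMSE μ i θ' := by
  simpa using le_add_sum_of_update_le (fun ϑ => -blockMMSE μ i ϑ) θ θ' 0 fun A j => by
    have := isProbabilityMeasure_piecewise (θ := θ) (θ' := θ') A
    simpa using blockMMSE_update_le μ i (A.piecewise θ' θ) j (h j)

lemma sum_blockMMSE_mul_le_blockEntropy_sub (hθ : ∀ j, IsSymmetricLaw (θ j))
    (hθ' : ∀ j, IsSymmetricLaw (θ' j)) (h : ∀ j, ConvexDominates (θ j) (θ' j)) :
    ∑ i, blockMMSE μ i θ * (meanEntropy (θ' i) - meanEntropy (θ i)) ≤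
      blockEntropy μ θ' - blockEntropy μ θ := by
  have htele := le_add_sum_of_update_le (fun ϑ => -blockEntropy μ ϑ) θ θ'
    (fun i => -(blockMMSE μ i θ * (meanEntropy (θ' i) - meanEntropy (θ i)))) fun A i => by
      have := isProbabilityMeasure_piecewise (θ := θ) (θ' := θ') A
      have hmono : blockMMSE μ i θ ≤ blockMMSE μ i (A.piecewise θ' θ) :=
        blockMMSE_mono μ i fun j => A.piecewise_cases θ' θ _ (h j) (ConvexDominates.refl _)
      have hgap := mul_le_mul_of_nonneg_right hmono (sub_nonneg.2 (h i).meanEntropy_le)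
      linarith [le_blockEntropy_update_sub μ i (A.piecewise θ' θ) (hθ i) (hθ' i) (h i)]
  rw [Finset.sum_neg_distrib] at htele
  linarith

variable [IsProbabilityMeasure μ]

lemma blockEntropy_sub_le_sum (hθ : ∀ j, IsSymmetricLaw (θ j))
    (hθ' : ∀ j, IsSymmetricLaw (θ' j)) (h : ∀ j, ConvexDominates (θ j) (θ' j)) :
    blockEntropy μ θ' - blockEntropy μ θ ≤ ∑ i, (meanEntropy (θ' i) - meanEntropy (θ i)) := by
  refine sub_le_iff_le_add'.2 (le_add_sum_of_update_le (blockEntropy μ) θ θ' _ fun A i => ?_)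
  have := isProbabilityMeasure_piecewise (θ := θ) (θ' := θ') A
  exact sub_le_iff_le_add'.1 (blockEntropy_update_sub_le μ i
    (isSymmetricLaw_piecewise hθ hθ' A) (hθ i) (hθ' i) (h i))

lemma blockEntropy_sub_le_sum_of_perfect (hθ : ∀ j, IsSymmetricLaw (θ j))
    (hθ' : ∀ j, IsSymmetricLaw (θ' j)) (h : ∀ j, ConvexDominates (θ j) (θ' j))
    (hperfect : ∀ j, ∀ᵐ d : Bias ∂θ j, |(d : ℝ)| = 1) :
    blockEntropy μ θ' - blockEntropy μ θ ≤ ∑ i, signEntropy (√(1 - blockMMSE μ i θ')) := by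
  refine sub_le_iff_le_add'.2 (le_add_sum_of_update_le (blockEntropy μ) θ θ' _ fun A i => ?_)
  have := isProbabilityMeasure_piecewise (θ := θ) (θ' := θ') A
  have hmono : blockMMSE μ i (A.piecewise θ' θ) ≤ blockMMSE μ i θ' :=
    blockMMSE_mono μ i fun j => A.piecewise_cases θ' θ (ConvexDominates · (θ' j))
      (ConvexDominates.refl _) (h j)
  have hmem (ϑ : ι → Measure Bias) : √(1 - blockMMSE μ i ϑ) ∈ Icc (0 : ℝ) 1 :=
    ⟨sqrt_nonneg _, sqrt_le_one.2 (sub_le_self _ (blockMMSE_nonneg μ i ϑ))⟩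
  refine sub_le_iff_le_add'.1 ((blockEntropy_update_sub_le_of_perfect μ i
    (isSymmetricLaw_piecewise hθ hθ' A) (hθ i) (hθ' i) (hperfect i)).trans ?_)
  exact antitoneOn_signEntropy (hmem _) (hmem _) (sqrt_le_sqrt (sub_le_sub_left hmono 1))

lemma blockEntropy_of_perfect (μ : Measure (ι → Bool))
    (hperfect : ∀ j, ∀ᵐ d : Bias ∂θ j, |(d : ℝ)| = 1) : blockEntropy μ θ = 0 := by
  refine integral_eq_zero_of_ae ?_
  filter_upwards [ae_pi_forall hperfect] with d hd
  have hsign (j : ι) : ∃ b, (d j : ℝ) = bpsk b := by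
    rcases eq_or_eq_neg_of_abs_eq (hd j) with h | h
    · exact ⟨false, by simp [h, bpsk]⟩
    · exact ⟨true, by simp [h, bpsk]⟩
  choose y hy using hsign
  have hlikelihood (x : ι → Bool) (hx : x ≠ y) : likelihood Finset.univ x d = 0 := by
    obtain ⟨j, hj⟩ := Function.ne_iff.1 hx
    refine Finset.prod_eq_zero (Finset.mem_univ j) ?_
    rw [hy]
    revert hj
    cases x j <;> cases y j <;> simp [bpsk]
  simp only [entDensity, evidence, Pi.zero_apply]
  rw [Fintype.sum_eq_single y fun x hx => by simp [hlikelihood x hx],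
    Fintype.sum_eq_single y fun x hx => by simp [hlikelihood x hx], sub_self]

lemma blockEntropy_of_uninformative (h : ∀ j, ∀ᵐ d : Bias ∂θ j, (d : ℝ) = 0) :
    blockEntropy μ θ = ∑ x, negMulLog (μ.real {x}) := by
  have hconst : entDensity μ Finset.univ =ᵐ[Measure.pi θ] fun _ => ∑ x, negMulLog (μ.real {x}) := by
    filter_upwards [ae_pi_forall h] with d hd
    simp [entDensity, evidence, likelihood, hd]
  rw [blockEntropy, integral_congr_ae hconst, integral_const, probReal_univ, one_smul]

end Degrading

section Symmetry

variable {ι : Type*} {μ : Measure (ι → Bool)} {σ : Equiv.Perm ι}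

lemma measureReal_comp_perm [Finite ι] (hσ : μ.map (fun x k => x (σ k)) = μ) (x : ι → Bool) :
    μ.real {fun k => x (σ k)} = μ.real {x} := by
  have hinj : Injective fun (x : ι → Bool) k => x (σ k) := σ.surjective.injective_comp_right
  conv_lhs => rw [← hσ, map_measureReal_apply (by fun_prop) (measurableSet_singleton _)]
  rw [← image_singleton (f := fun (x : ι → Bool) k => x (σ k)), hinj.preimage_image]

variable [Fintype ι] [DecidableEq ι]

lemma likelihood_comp_perm (σ : Equiv.Perm ι) (i : ι) (x : ι → Bool) (d : ι → Bias) :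
    likelihood (Finset.univ.erase i) (fun k => x (σ k)) (fun k => d (σ k)) =
      likelihood (Finset.univ.erase (σ i)) x d :=
  Finset.prod_equiv σ (by simp) fun _ _ => rfl

lemma sum_comp_perm (σ : Equiv.Perm ι) (f : (ι → Bool) → ℝ) :
    ∑ x : ι → Bool, f (fun k => x (σ k)) = ∑ x, f x :=
  Equiv.sum_comp (Equiv.arrowCongr σ.symm (Equiv.refl Bool)) f

lemma errDensity_comp_perm (hσ : μ.map (fun x k => x (σ k)) = μ) (i : ι) (d : ι → Bias) :
    errDensity μ (Finset.univ.erase i) i (fun k => d (σ k)) =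
      errDensity μ (Finset.univ.erase (σ i)) (σ i) d := by
  have hevidence : evidence μ (Finset.univ.erase i) (fun k => d (σ k)) =
      evidence μ (Finset.univ.erase (σ i)) d := by
    rw [evidence, ← sum_comp_perm σ]
    simp only [measureReal_comp_perm hσ, likelihood_comp_perm, evidence]
  have hmean : evidenceMean μ (Finset.univ.erase i) i (fun k => d (σ k)) =
      evidenceMean μ (Finset.univ.erase (σ i)) (σ i) d := by
    rw [evidenceMean, ← sum_comp_perm σ]
    simp only [measureReal_comp_perm hσ, likelihood_comp_perm, evidenceMean]
  rw [errDensity, errDensity, postMean, postMean, hevidence, hmean]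

lemma blockMMSE_perm (hσ : μ.map (fun x k => x (σ k)) = μ) (i : ι) (m : Measure Bias)
    [SigmaFinite m] : blockMMSE μ (σ i) (fun _ => m) = blockMMSE μ i (fun _ => m) := by
  have hpres := measurePreserving_piCongrLeft (fun _ : ι => m) σ.symm
  rw [eq_comm, blockMMSE, blockMMSE, ← hpres.integral_comp']
  congr 1 with d
  rw [← errDensity_comp_perm hσ]
  congr 1 with k
  have happly := Equiv.piCongrLeft_apply_apply (fun _ : ι => Bias) σ.symm d (σ k)
  rw [Equiv.symm_apply_apply] at happly
  rw [MeasurableEquiv.coe_piCongrLeft, happly]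

end Symmetry

lemma HasTransitiveSymmetry.blockMMSE_eq {N : ℕ} {μ : Measure (Fin N → Bool)}
    (hμ : HasTransitiveSymmetry μ) (i j : Fin N) (m : Measure Bias) [SigmaFinite m] :
    blockMMSE μ j (fun _ => m) = blockMMSE μ i (fun _ => m) := by
  obtain ⟨σ, hσ, rfl⟩ := hμ i j
  exact blockMMSE_perm hσ i m

/-! ### Conditional expectations from joint densities -/

section Estimator

variable {A E : Type*} [Fintype A]

/-- The conditional mean of `φ X` given `Y = y`, when `l a` is the density of `Y` on the event
`X = a`. It is `0` where the density of `Y` vanishes. -/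
noncomputable def estimator (l : A → E → ℝ) (φ : A → ℝ) (y : E) : ℝ :=
  (∑ a, φ a * l a y) / ∑ a, l a y

lemma estimator_mul_sum {l : A → E → ℝ} (hl : ∀ a y, 0 ≤ l a y) (φ : A → ℝ) (y : E) :
    estimator l φ y * ∑ a, l a y = ∑ a, φ a * l a y := by
  refine div_mul_cancel_of_imp fun hsum => ?_
  have hzero := (Finset.sum_eq_zero_iff_of_nonneg fun a _ => hl a y).1 hsum
  exact Finset.sum_eq_zero fun a ha => by rw [hzero a ha, mul_zero]

lemma abs_le_sum_abs (φ : A → ℝ) (a : A) : |φ a| ≤ ∑ b, |φ b| :=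
  Finset.single_le_sum (f := fun b => |φ b|) (fun _ _ => abs_nonneg _) (Finset.mem_univ a)

lemma abs_estimator_le {l : A → E → ℝ} (hl : ∀ a y, 0 ≤ l a y) (φ : A → ℝ) (y : E) :
    |estimator l φ y| ≤ ∑ a, |φ a| := by
  have hsum : 0 ≤ ∑ a, l a y := Finset.sum_nonneg fun a _ => hl a y
  rw [estimator, abs_div, abs_of_nonneg hsum]
  refine div_le_of_le_mul₀ hsum (Finset.sum_nonneg fun a _ => abs_nonneg _) ?_
  rw [Finset.mul_sum]
  refine (Finset.abs_sum_le_sum_abs _ _).trans (Finset.sum_le_sum fun a _ => ?_)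
  rw [abs_mul, abs_of_nonneg (hl a y)]
  exact mul_le_mul_of_nonneg_right (abs_le_sum_abs φ a) (hl a y)

lemma sum_mul_sum_negMulLog_div {w : A → ℝ} (hw : ∀ a, 0 ≤ w a) :
    (∑ a, w a) * ∑ a, negMulLog (w a / ∑ b, w b) =
      ∑ a, negMulLog (w a) - negMulLog (∑ a, w a) := by
  rcases eq_or_ne (∑ a, w a) 0 with hsum | hsum
  · have hzero := (Finset.sum_eq_zero_iff_of_nonneg fun a _ => hw a).1 hsum
    rw [hsum, zero_mul, negMulLog_zero, sub_zero, eq_comm]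
    exact Finset.sum_eq_zero fun a ha => by rw [hzero a ha, negMulLog_zero]
  · have hterm (a : A) : (∑ b, w b) * negMulLog (w a / ∑ b, w b) =
        negMulLog (w a) + w a * log (∑ b, w b) := by
      conv_rhs => rw [← mul_div_cancel₀ (w a) hsum, negMulLog_mul]
      simp only [negMulLog]
      field_simp
      ring
    rw [Finset.mul_sum, Finset.sum_congr rfl fun a _ => hterm a, Finset.sum_add_distrib,
      ← Finset.sum_mul, negMulLog]
    ring

lemma measurable_estimator [MeasurableSpace E] {l : A → E → ℝ} (hl : ∀ a, Measurable (l a))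
    (φ : A → ℝ) : Measurable (estimator l φ) :=
  (Finset.measurable_fun_sum _ fun a _ => (hl a).const_mul _).div
    (Finset.measurable_fun_sum _ fun a _ => hl a)

end Estimator

section JointDensity

variable {Ω A E : Type*} [MeasurableSpace Ω] [MeasurableSpace A] [mE : MeasurableSpace E]

/-- `l` is the joint density, with respect to `ρ` in the second variable, of the pair `(X, Y)` with
`X` discrete. -/
structure HasJointDensity (P : Measure Ω) (X : Ω → A) (Y : Ω → E) (ρ : Measure E)
    (l : A → E → ℝ) : Prop where
  measurable_fst : Measurable X
  measurable_snd : Measurable Y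
  measurable_density : ∀ a, Measurable (l a)
  nonneg : ∀ a y, 0 ≤ l a y
  map_restrict : ∀ a,
    (P.restrict (X ⁻¹' {a})).map Y = ρ.withDensity fun y => ENNReal.ofReal (l a y)

lemma hasJointDensity_prod {B : Type*} [MeasurableSpace B] [Countable A]
    [MeasurableSingletonClass A] (μ : Measure A) [IsFiniteMeasure μ] (κ : Measure B) [SFinite κ]
    (ρ : Measure E) {F : A → B → E} (hF : ∀ a, Measurable (F a)) {l : A → E → ℝ}
    (hl : ∀ a, Measurable (l a)) (hl0 : ∀ a y, 0 ≤ l a y)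
    (hκ : ∀ a, κ.map (F a) = ρ.withDensity fun y => ENNReal.ofReal (l a y)) :
    HasJointDensity (μ.prod κ) (fun ω => ω.1) (fun ω => F ω.1 ω.2) ρ
      (fun a y => μ.real {a} * l a y) where
  measurable_fst := measurable_fst
  measurable_snd := measurable_from_prod_countable_right hF
  measurable_density a := (hl a).const_mul _
  nonneg a y := mul_nonneg measureReal_nonneg (hl0 a y)
  map_restrict a := by
    have hpreimage : (fun ω : A × B => ω.1) ⁻¹' {a} = {a} ×ˢ univ := by ext; simp
    have hmeas : Measurable fun ω : A × B => F ω.1 ω.2 := measurable_from_prod_countable_right hF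
    rw [hpreimage, ← Measure.prod_restrict, Measure.restrict_univ, Measure.restrict_singleton,
      Measure.prod_smul_left, Measure.map_smul, Measure.dirac_prod,
      Measure.map_map hmeas measurable_prodMk_left]
    change μ {a} • κ.map (F a) = _
    rw [hκ, ← withDensity_smul _ (hl a).ennreal_ofReal]
    congr 1 with y
    rw [Pi.smul_apply, smul_eq_mul, ENNReal.ofReal_mul measureReal_nonneg, ofReal_measureReal]

namespace HasJointDensity

variable {P : Measure Ω} {X : Ω → A} {Y : Ω → E} {ρ : Measure E} {l : A → E → ℝ}

lemma setIntegral_comp (h : HasJointDensity P X Y ρ l) {g : E → ℝ} (hg : Measurable g) (a : A) :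
    ∫ ω in X ⁻¹' {a}, g (Y ω) ∂P = ∫ y, l a y * g y ∂ρ := by
  rw [← integral_map h.measurable_snd.aemeasurable hg.aestronglyMeasurable, h.map_restrict,
    integral_withDensity_ofReal (h.measurable_density a) (h.nonneg a)]

variable [IsFiniteMeasure P]

lemma integrable_density_mul (h : HasJointDensity P X Y ρ l) {g : E → ℝ} (hg : Measurable g)
    {c : ℝ} (hc : ∀ y, |g y| ≤ c) (a : A) : Integrable (fun y => l a y * g y) ρ := by
  rw [← integrable_withDensity_ofReal (h.measurable_density a) (h.nonneg a), ← h.map_restrict]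
  exact .of_bound hg.aestronglyMeasurable c (ae_of_all _ hc)

variable [Fintype A] [MeasurableSingletonClass A]

lemma integral_comp (h : HasJointDensity P X Y ρ l) {g : A → E → ℝ} (hg : ∀ a, Measurable (g a))
    {c : ℝ} (hc : ∀ a y, |g a y| ≤ c) :
    ∫ ω, g (X ω) (Y ω) ∂P = ∫ y, ∑ a, l a y * g a y ∂ρ := by
  have hmeas : Measurable fun ω => g (X ω) (Y ω) :=
    (measurable_from_prod_countable_right (f := fun p : A × E => g p.1 p.2) hg).comp
      (h.measurable_fst.prodMk h.measurable_snd)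
  have hint : Integrable (fun ω => g (X ω) (Y ω)) P :=
    .of_bound hmeas.aestronglyMeasurable c (ae_of_all _ fun ω => hc _ _)
  have hfiber (a : A) : MeasurableSet (X ⁻¹' {a}) := h.measurable_fst (measurableSet_singleton a)
  have huniv : univ = ⋃ a, X ⁻¹' {a} := by ext; simp
  rw [integral_finsetSum _ fun a _ => h.integrable_density_mul (hg a) (hc a) a, ← setIntegral_univ,
    huniv, integral_iUnion_fintype hfiber
      (fun a b hab => (disjoint_singleton.2 hab).preimage X) fun a => hint.integrableOn]
  refine Finset.sum_congr rfl fun a _ => ?_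
  rw [← h.setIntegral_comp (hg a)]
  exact setIntegral_congr_fun (hfiber a) fun ω (hω : X ω = a) => by simp only [hω]

lemma setIntegral_estimator (h : HasJointDensity P X Y ρ l) (φ : A → ℝ) {B : Set E}
    (hB : MeasurableSet B) :
    ∫ ω in Y ⁻¹' B, estimator l φ (Y ω) ∂P = ∫ ω in Y ⁻¹' B, φ (X ω) ∂P := by
  have hest := measurable_estimator h.measurable_density φ
  have hbound {f : E → ℝ} (y : E) (hf : |f y| ≤ ∑ a, |φ a|) : |B.indicator f y| ≤ ∑ a, |φ a| :=
    (norm_indicator_le_norm_self f y : |B.indicator f y| ≤ |f y|).trans hf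
  rw [← integral_indicator (h.measurable_snd hB), ← integral_indicator (h.measurable_snd hB)]
  refine (h.integral_comp (g := fun _ y => B.indicator (estimator l φ) y)
    (fun _ => hest.indicator hB) fun _ y => hbound y (abs_estimator_le h.nonneg φ y)).trans
    (Eq.trans ?_ (h.integral_comp (g := fun a => B.indicator fun _ => φ a)
      (fun _ => measurable_const.indicator hB) fun a y => hbound y (abs_le_sum_abs φ a)).symm)
  congr 1 with y
  by_cases hy : y ∈ B
  · simp only [hy, indicator_of_mem, ← Finset.sum_mul]
    rw [mul_comm, estimator_mul_sum h.nonneg]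
    exact Finset.sum_congr rfl fun a _ => mul_comm _ _
  · simp [hy]

lemma condExp_eq (h : HasJointDensity P X Y ρ l) (φ : A → ℝ) :
    P[fun ω => φ (X ω) | mE.comap Y] =ᵐ[P] fun ω => estimator l φ (Y ω) := by
  have hest := measurable_estimator h.measurable_density φ
  have hφ : Measurable fun ω => φ (X ω) := (measurable_of_finite φ).comp h.measurable_fst
  symm
  refine ae_eq_condExp_of_forall_setIntegral_eq h.measurable_snd.comap_le
    (.of_bound hφ.aestronglyMeasurable _ (ae_of_all _ fun ω => abs_le_sum_abs φ (X ω)))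
    (fun s _ _ => ?_) ?_ (hest.comp (comap_measurable Y)).aestronglyMeasurable
  · exact Integrable.integrableOn (.of_bound (hest.comp h.measurable_snd).aestronglyMeasurable _
      (ae_of_all _ fun ω => abs_estimator_le h.nonneg φ (Y ω)))
  · rintro s ⟨B, hB, rfl⟩ -
    exact h.setIntegral_estimator φ hB

lemma mmse_eq (h : HasJointDensity P X Y ρ l) {φ : A → ℝ} (hφ : ∀ a, φ a ^ 2 = 1) :
    mmse P (fun ω => φ (X ω)) Y = ∫ y, (∑ a, l a y) * (1 - estimator l φ y ^ 2) ∂ρ := by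
  have hest : (fun ω => (φ (X ω) - (P[fun ω => φ (X ω) | mE.comap Y]) ω) ^ 2) =ᵐ[P]
      fun ω => (φ (X ω) - estimator l φ (Y ω)) ^ 2 := by
    filter_upwards [h.condExp_eq φ] with ω hω
    rw [hω]
  have hbound (a : A) (y : E) :
      |(φ a - estimator l φ y) ^ 2| ≤ (∑ a, |φ a| + ∑ a, |φ a|) ^ 2 := by
    rw [abs_pow]
    exact pow_le_pow_left₀ (abs_nonneg _) ((abs_sub _ _).trans
      (add_le_add (abs_le_sum_abs φ a) (abs_estimator_le h.nonneg φ y))) 2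
  rw [mmse, integral_congr_ae hest, h.integral_comp (g := fun a y => (φ a - estimator l φ y) ^ 2)
    (fun a => ((measurable_estimator h.measurable_density φ).const_sub _).pow_const 2) hbound]
  congr 1 with y
  have hexpand (a : A) : l a y * (φ a - estimator l φ y) ^ 2 =
      l a y - 2 * estimator l φ y * (φ a * l a y) + estimator l φ y ^ 2 * l a y := by
    linear_combination l a y * hφ a
  simp only [hexpand, Finset.sum_add_distrib, Finset.sum_sub_distrib, ← Finset.mul_sum]
  linear_combination 2 * estimator l φ y * estimator_mul_sum h.nonneg φ y

lemma condExp_indicator_eq (h : HasJointDensity P X Y ρ l) (a : A) :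
    P⟦X ⁻¹' {a} | mE.comap Y⟧ =ᵐ[P] fun ω => l a (Y ω) / ∑ b, l b (Y ω) := by
  classical
  have hindicator : (X ⁻¹' {a}).indicator (fun _ => (1 : ℝ)) =
      fun ω => (fun b => if b = a then 1 else 0) (X ω) := by
    ext ω
    by_cases hω : X ω = a <;> simp [hω]
  rw [hindicator]
  simpa [estimator] using h.condExp_eq fun b => if b = a then 1 else 0

lemma condEntropy_eq (h : HasJointDensity P X Y ρ l) :
    condEntropy P X Y =
      (∫ y, (∑ a, negMulLog (l a y) - negMulLog (∑ a, l a y)) ∂ρ) / log 2 := by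
  have hposterior : (fun ω => ∑ a, negMulLog ((P⟦X ⁻¹' {a} | mE.comap Y⟧) ω)) =ᵐ[P]
      fun ω => ∑ a, negMulLog (l a (Y ω) / ∑ b, l b (Y ω)) := by
    filter_upwards [ae_all_iff.2 h.condExp_indicator_eq] with ω hω
    simp only [hω]
  have hmeas : Measurable fun y => ∑ a, negMulLog (l a y / ∑ b, l b y) :=
    Finset.measurable_fun_sum _ fun a _ => continuous_negMulLog.measurable.comp
      ((h.measurable_density a).div (Finset.measurable_fun_sum _ fun b _ => h.measurable_density b))
  have hbound (y : E) : |∑ a, negMulLog (l a y / ∑ b, l b y)| ≤ ∑ _a : A, (1 : ℝ) := by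
    refine (Finset.abs_sum_le_sum_abs _ _).trans (Finset.sum_le_sum fun a _ => ?_)
    have hsum : l a y ≤ ∑ b, l b y :=
      Finset.single_le_sum (f := fun b => l b y) (fun b _ => h.nonneg b y) (Finset.mem_univ a)
    have hnonneg := div_nonneg (h.nonneg a y) ((h.nonneg a y).trans hsum)
    rw [abs_of_nonneg (negMulLog_nonneg hnonneg
      (div_le_one_of_le₀ hsum ((h.nonneg a y).trans hsum)))]
    exact (negMulLog_le_one_sub_self hnonneg).trans (sub_le_self _ hnonneg)
  rw [condEntropy, integral_congr_ae hposterior,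
    h.integral_comp (g := fun _ y => ∑ a, negMulLog (l a y / ∑ b, l b y)) (fun _ => hmeas)
      fun _ => hbound]
  congr 2 with y
  rw [← Finset.sum_mul, sum_mul_sum_negMulLog_div (fun a => h.nonneg a y)]

end HasJointDensity

end JointDensity

/-! ### The bias of a channel -/

section Channel

@[fun_prop]
lemma measurable_output (b : Bool) : Measurable (output b) := by
  have hout : output b = if b then Neg.neg else id := by
    funext y
    cases b <;> simp [output, bpsk]
  rw [hout]
  cases b
  exacts [measurable_id, continuous_neg.measurable]

lemma neg_output (b : Bool) (y : EReal) : -output b y = output (!b) y := by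
  cases b <;> simp [output, bpsk]

variable (ν : Measure EReal)

lemma map_neg_transition (b : Bool) : (transition ν b).map Neg.neg = transition ν (!b) := by
  rw [transition, transition, Measure.map_map continuous_neg.measurable (measurable_output b)]
  congr 1 with y
  exact neg_output b y

/-- Law of the channel output for a uniform input. -/
noncomputable def outLaw : Measure EReal :=
  (2 : ENNReal)⁻¹ • (transition ν false + transition ν true)

lemma two_smul_outLaw : (2 : ENNReal) • outLaw ν = transition ν false + transition ν true := by
  rw [outLaw, smul_smul, ENNReal.mul_inv_cancel (by simp) (by simp), one_smul]

lemma transition_false_le : transition ν false ≤ (2 : ENNReal) • outLaw ν := by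
  rw [two_smul_outLaw]
  exact Measure.le_add_right le_rfl

lemma map_neg_outLaw : (outLaw ν).map Neg.neg = outLaw ν := by
  rw [outLaw, Measure.map_smul, Measure.map_add _ _ continuous_neg.measurable, map_neg_transition,
    map_neg_transition, add_comm]
  rfl

/-- Posterior mean of a uniform input given the channel output. The projection onto `[-1,1]` only
matters on a null set. -/
noncomputable def bias (y : EReal) : Bias :=
  projIcc (-1) 1 (by norm_num) (((transition ν false).rnDeriv (outLaw ν) y).toReal - 1)

/-- Law of the posterior mean of a uniform input given the channel output. -/
noncomputable def biasLaw : Measure Bias := (outLaw ν).map (bias ν)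

@[fun_prop]
lemma measurable_bias : Measurable (bias ν) :=
  continuous_projIcc.measurable.comp ((Measure.measurable_rnDeriv _ _).ennreal_toReal.sub_const 1)

lemma integral_biasLaw {f : Bias → ℝ} (hf : Continuous f) :
    ∫ d, f d ∂biasLaw ν = ∫ y, f (bias ν y) ∂outLaw ν :=
  integral_map (measurable_bias ν).aemeasurable hf.aestronglyMeasurable

variable [IsProbabilityMeasure ν]

instance (b : Bool) : IsProbabilityMeasure (transition ν b) :=
  Measure.isProbabilityMeasure_map (measurable_output b).aemeasurable

instance : IsProbabilityMeasure (outLaw ν) where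
  measure_univ := by
    simp only [outLaw, Measure.smul_apply, Measure.add_apply, measure_univ, smul_eq_mul]
    rw [one_add_one_eq_two, ENNReal.inv_mul_cancel (by simp) (by simp)]

instance : IsProbabilityMeasure (biasLaw ν) :=
  Measure.isProbabilityMeasure_map (measurable_bias ν).aemeasurable

lemma transition_false_eq :
    transition ν false = (outLaw ν).withDensity fun y => ENNReal.ofReal (1 + bias ν y) := by
  have hac : transition ν false ≪ outLaw ν :=
    (Measure.absolutelyContinuous_of_le (transition_false_le ν)).trans
      Measure.smul_absolutelyContinuous
  have hle : ∀ᵐ y ∂outLaw ν, (transition ν false).rnDeriv (outLaw ν) y ≤ 2 := by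
    refine ae_le_of_forall_setLIntegral_le_of_sigmaFinite (Measure.measurable_rnDeriv _ _)
      fun s _ _ => ?_
    rw [setLIntegral_const, Measure.setLIntegral_rnDeriv hac]
    exact transition_false_le ν s
  conv_lhs => rw [← Measure.withDensity_rnDeriv_eq _ _ hac]
  refine withDensity_congr_ae ?_
  filter_upwards [hle] with y hy
  have hreal : ((transition ν false).rnDeriv (outLaw ν) y).toReal - 1 ∈ Icc (-1 : ℝ) 1 := by
    have hle2 := ENNReal.toReal_mono (by simp) hy
    have hnonneg := ENNReal.toReal_nonneg (a := (transition ν false).rnDeriv (outLaw ν) y)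
    simp only [ENNReal.toReal_ofNat] at hle2
    exact ⟨by linarith, by linarith⟩
  rw [bias, projIcc_of_mem _ hreal]
  simp only [add_sub_cancel]
  rw [ENNReal.ofReal_toReal (ne_top_of_le_ne_top (by simp) hy)]

lemma transition_eq (b : Bool) :
    transition ν b =
      (outLaw ν).withDensity fun y => ENNReal.ofReal (1 + bpsk b * bias ν y) := by
  cases b
  · simpa [bpsk] using transition_false_eq ν
  · have hsum : transition ν false + transition ν true = transition ν false +
        (outLaw ν).withDensity fun y => ENNReal.ofReal (1 + bpsk true * bias ν y) := by
      conv_rhs => rw [transition_false_eq ν]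
      rw [← two_smul_outLaw, ← withDensity_add_left (by fun_prop), ← withDensity_const]
      congr 1 with y
      rw [Pi.add_apply, ← ENNReal.ofReal_add (by linarith [(bias ν y).2.1])
        (one_add_bpsk_mul_nonneg true (bias ν y))]
      simp only [bpsk, if_true]
      ring_nf
      simp
    ext s _
    have happly := congrArg (fun m : Measure EReal => m s) hsum
    simp only [Measure.add_apply] at happly
    exact (ENNReal.add_right_inj (measure_ne_top _ _)).1 happly

lemma bias_neg : ∀ᵐ y ∂outLaw ν, (bias ν (-y) : ℝ) = -bias ν y := by
  have hneg : Measurable (Neg.neg : EReal → EReal) := continuous_neg.measurable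
  have hdensity : (outLaw ν).withDensity (fun y => ENNReal.ofReal (1 + bias ν (-y))) =
      (outLaw ν).withDensity fun y => ENNReal.ofReal (1 + bpsk true * bias ν y) := by
    rw [← transition_eq, ← Bool.not_false, ← map_neg_transition]
    ext s hs
    rw [withDensity_apply _ hs, Measure.map_apply hneg hs, transition_false_eq,
      withDensity_apply _ (hneg hs)]
    conv_lhs => rw [← map_neg_outLaw ν]
    rw [setLIntegral_map hs (by fun_prop) hneg]
    simp
  have hfinite : ∫⁻ y, ENNReal.ofReal (1 + bias ν (-y)) ∂outLaw ν ≠ ⊤ := by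
    rw [← setLIntegral_univ, ← withDensity_apply _ MeasurableSet.univ, hdensity, ← transition_eq]
    simp
  filter_upwards [(withDensity_eq_iff (by fun_prop) (by fun_prop) hfinite).1 hdensity] with y hy
  rw [ENNReal.ofReal_eq_ofReal_iff (by linarith [(bias ν (-y)).2.1])
    (one_add_bpsk_mul_nonneg true (bias ν y))] at hy
  simp only [bpsk, if_true] at hy
  linarith

lemma isSymmetricLaw_biasLaw : IsSymmetricLaw (biasLaw ν) := by
  have hreflect : Bias.reflect ∘ bias ν =ᵐ[outLaw ν] bias ν ∘ Neg.neg := by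
    filter_upwards [bias_neg ν] with y hy
    exact Subtype.ext hy.symm
  refine ⟨Bias.continuous_reflect.measurable, ?_⟩
  rw [biasLaw, Measure.map_map Bias.continuous_reflect.measurable (measurable_bias ν),
    Measure.map_congr hreflect, ← Measure.map_map (measurable_bias ν) continuous_neg.measurable,
    map_neg_outLaw]

lemma integral_transition (b : Bool) (g : EReal → ℝ) :
    ∫ y, g y ∂transition ν b = ∫ y, (1 + bpsk b * bias ν y) * g y ∂outLaw ν := by
  rw [transition_eq, integral_withDensity_ofReal (by fun_prop)
    fun y => one_add_bpsk_mul_nonneg b (bias ν y)]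

lemma integral_bias_mul {g : EReal → ℝ} (hg : Measurable g) {c : ℝ} (hc : ∀ y, |g y| ≤ c) :
    ∫ y, bias ν y * g y ∂outLaw ν = ∫ y, g y ∂transition ν false - ∫ y, g y ∂outLaw ν := by
  have hint : Integrable g (outLaw ν) := .of_bound hg.aestronglyMeasurable c (ae_of_all _ hc)
  have hint_mul : Integrable (fun y => bias ν y * g y) (outLaw ν) :=
    hint.bdd_mul (c := 1) (Measurable.aestronglyMeasurable (by fun_prop))
      (ae_of_all _ fun y => abs_le.2 (bias ν y).2)
  have hexpand (y : EReal) : (1 + bpsk false * bias ν y) * g y = bias ν y * g y + g y := by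
    simp only [bpsk, Bool.false_eq_true, if_false]
    ring
  rw [integral_transition]
  simp only [hexpand]
  rw [integral_add hint_mul hint, add_sub_cancel_right]

lemma setIntegral_bias {B : Set EReal} (hB : MeasurableSet B) :
    ∫ y in B, (bias ν y : ℝ) ∂outLaw ν = (transition ν false).real B - (outLaw ν).real B := by
  have h := integral_bias_mul ν (measurable_one.indicator hB) (c := 1) fun y =>
    (norm_indicator_le_norm_self 1 y).trans (norm_one (α := ℝ)).le
  rw [integral_indicator_one hB, integral_indicator_one hB] at h
  rw [← h, ← integral_indicator hB]
  congr 1 with y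
  by_cases hy : y ∈ B <;> simp [hy]

end Channel

section Degradation

lemma integral_kernel_real {E F : Type*} [MeasurableSpace E] [MeasurableSpace F] (μ : Measure E)
    (K : Kernel E F) [IsMarkovKernel K] {B : Set F} (hB : MeasurableSet B) :
    ∫ y, (K y).real B ∂μ = (μ.bind K).real B := by
  rw [measureReal_def, Measure.bind_apply hB K.measurable.aemeasurable]
  exact integral_toReal (K.measurable_coe hB).aemeasurable (ae_of_all _ fun y => measure_lt_top _ _)

lemma convexDominates_of_condExp {Ω : Type*} {m₀ mΩ : MeasurableSpace Ω} {P : Measure Ω}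
    [IsProbabilityMeasure P] (hm₀ : m₀ ≤ mΩ) {D D' : Ω → Bias} (hD : Measurable D)
    (hD' : Measurable D') (h : (fun ω => (D' ω : ℝ)) =ᵐ[P] P[fun ω => (D ω : ℝ) | m₀]) :
    ConvexDominates (P.map D) (P.map D') := by
  intro f hf hcont
  have hcont' : Continuous fun d : Bias => f d := continuousOn_iff_continuous_domRestrict.1 hcont
  have hint {G : Ω → Bias} (hG : Measurable G) : Integrable (fun ω => f (G ω)) P :=
    (integrable_of_continuous (P.map G) hcont').comp_measurable hG
  have hjensen := hf.condExp_map_le hm₀ hcont.upperSemicontinuousOn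
    (ae_of_all _ fun ω => (D ω).2) isClosed_Icc
    ((integrable_of_continuous (P.map D) continuous_subtype_val).comp_measurable hD) (hint hD)
  rw [integral_map hD.aemeasurable hcont'.aestronglyMeasurable,
    integral_map hD'.aemeasurable hcont'.aestronglyMeasurable, ← integral_condExp hm₀]
  refine integral_mono_ae integrable_condExp (hint hD') ?_
  filter_upwards [hjensen, h] with ω hω hω'
  exact hω.trans_eq (by rw [comp_apply, ← hω'])

variable {ν ν' : Measure EReal} {K : Kernel EReal EReal}

lemma outLaw_eq_bind (hK : ∀ b, transition ν' b = (transition ν b).bind K) :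
    outLaw ν' = (outLaw ν).bind K := by
  ext s hs
  rw [Measure.bind_apply hs K.measurable.aemeasurable, outLaw, outLaw, lintegral_smul_measure,
    lintegral_add_measure, hK, hK]
  simp only [Measure.smul_apply, Measure.add_apply,
    Measure.bind_apply hs K.measurable.aemeasurable]

variable [IsProbabilityMeasure ν]

lemma map_snd_outLaw_compProd [IsMarkovKernel K]
    (hK : ∀ b, transition ν' b = (transition ν b).bind K) :
    (outLaw ν ⊗ₘ K).map Prod.snd = outLaw ν' := by
  rw [outLaw_eq_bind hK]
  exact Measure.snd_compProd _ _

lemma setIntegral_bias_fst [IsMarkovKernel K]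
    (hK : ∀ b, transition ν' b = (transition ν b).bind K) {B : Set EReal} (hB : MeasurableSet B) :
    ∫ q in Prod.snd ⁻¹' B, (bias ν q.1 : ℝ) ∂(outLaw ν ⊗ₘ K) =
      (transition ν' false).real B - (outLaw ν').real B := by
  have hint : Integrable (fun q : EReal × EReal => (bias ν q.1 : ℝ)) (outLaw ν ⊗ₘ K) :=
    .of_bound (Measurable.aestronglyMeasurable (by fun_prop)) 1
      (ae_of_all _ fun q => abs_le.2 (bias ν q.1).2)
  have hreal : Measurable fun y => (K y).real B := (K.measurable_coe hB).ennreal_toReal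
  rw [← univ_prod, Measure.setIntegral_compProd .univ hB hint.integrableOn, hK,
    outLaw_eq_bind hK, ← integral_kernel_real _ K hB, ← integral_kernel_real _ K hB,
    ← integral_bias_mul ν hreal (c := 1) fun y =>
      (abs_of_nonneg measureReal_nonneg).trans_le measureReal_le_one]
  simp [mul_comm]

variable [IsProbabilityMeasure ν']

lemma condExp_bias [IsMarkovKernel K]
    (hK : ∀ b, transition ν' b = (transition ν b).bind K) :
    (fun q : EReal × EReal => (bias ν' q.2 : ℝ)) =ᵐ[outLaw ν ⊗ₘ K]
      (outLaw ν ⊗ₘ K)[fun q => (bias ν q.1 : ℝ) |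
        MeasurableSpace.comap Prod.snd inferInstance] := by
  have hmeas : Measurable fun y => (bias ν' y : ℝ) := by fun_prop
  have hint {G : EReal × EReal → Bias} (hG : Measurable G) :
      Integrable (fun q => (G q : ℝ)) (outLaw ν ⊗ₘ K) :=
    (integrable_of_continuous _ continuous_subtype_val).comp_measurable hG
  refine ae_eq_condExp_of_forall_setIntegral_eq measurable_snd.comap_le (hint (by fun_prop))
    (fun _ _ _ => (hint (by fun_prop)).integrableOn) ?_
    (hmeas.comp (comap_measurable Prod.snd)).aestronglyMeasurable
  rintro s ⟨B, hB, rfl⟩ -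
  rw [setIntegral_bias_fst hK hB, ← setIntegral_bias ν' hB, ← map_snd_outLaw_compProd hK,
    setIntegral_map hB hmeas.aestronglyMeasurable measurable_snd.aemeasurable]

lemma IsDegraded.convexDominates (h : IsDegraded ν' ν) :
    ConvexDominates (biasLaw ν) (biasLaw ν') := by
  obtain ⟨K, hmarkov, hK⟩ := h
  have hfst : (outLaw ν ⊗ₘ K).map Prod.fst = outLaw ν := Measure.fst_compProd _ _
  have hdom := convexDominates_of_condExp measurable_snd.comap_le
    ((measurable_bias ν).comp measurable_fst) ((measurable_bias ν').comp measurable_snd)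
    (condExp_bias hK)
  rwa [← Measure.map_map (measurable_bias ν) measurable_fst, hfst,
    ← Measure.map_map (measurable_bias ν') measurable_snd, map_snd_outLaw_compProd hK] at hdom

end Degradation

/-! ### Entropies and mean-squared errors in terms of the bias -/

lemma sum_real_singleton {A : Type*} [Fintype A] [MeasurableSpace A] [MeasurableSingletonClass A]
    (μ : Measure A) [IsProbabilityMeasure μ] : ∑ a, μ.real {a} = 1 := by
  rw [sum_measureReal_singleton, Finset.coe_univ, probReal_univ]

lemma entropy_id_nonneg {A : Type*} [Fintype A] [MeasurableSpace A] (μ : Measure A)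
    [IsProbabilityMeasure μ] : 0 ≤ entropy μ id :=
  div_nonneg (Finset.sum_nonneg fun _ _ => negMulLog_nonneg measureReal_nonneg measureReal_le_one)
    (log_pos one_lt_two).le

lemma entropy_id_le_logb_card {A : Type*} [Fintype A] [MeasurableSpace A]
    [MeasurableSingletonClass A] (μ : Measure A) [IsProbabilityMeasure μ] :
    entropy μ id ≤ logb 2 (Fintype.card A) := by
  have hcard : (0 : ℝ) < Fintype.card A :=
    Nat.cast_pos.2 (Fintype.card_pos_iff.2 (nonempty_of_isProbabilityMeasure μ))
  have hjensen := concaveOn_negMulLog.le_map_sum (t := Finset.univ)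
    (w := fun _ : A => (Fintype.card A : ℝ)⁻¹) (p := fun a => μ.real {a})
    (fun _ _ => by positivity) (by simp [hcard.ne']) fun _ _ => measureReal_nonneg
  simp only [smul_eq_mul, ← Finset.mul_sum, sum_real_singleton, mul_one, negMulLog, log_inv,
    neg_mul_neg, mul_le_mul_iff_right₀ (inv_pos.2 hcard)] at hjensen
  exact div_le_div_of_nonneg_right hjensen (log_pos one_lt_two).le

section SingleUse

variable (p : Measure Bool) (ν : Measure EReal) [IsProbabilityMeasure ν]

lemma entropy_singleLaw :
    entropy (singleLaw p ν) (fun ω => ω.1) = (∑ b, negMulLog (p.real {b})) / log 2 := by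
  have hfst (b : Bool) : (singleLaw p ν).real ((fun ω => ω.1) ⁻¹' {b}) = p.real {b} := by
    rw [← map_measureReal_apply measurable_fst (measurableSet_singleton b), singleLaw,
      Measure.map_fst_prod, measure_univ, one_smul]
  simp only [entropy, hfst]

variable [IsProbabilityMeasure p]

lemma hasJointDensity_singleLaw :
    HasJointDensity (singleLaw p ν) (fun ω => ω.1) singleOutput (outLaw ν)
      (fun b y => p.real {b} * (1 + bpsk b * bias ν y)) :=
  hasJointDensity_prod p ν (outLaw ν) measurable_output (fun b => by fun_prop)
    (fun b y => one_add_bpsk_mul_nonneg b (bias ν y)) (transition_eq ν)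

instance : IsProbabilityMeasure (singleLaw p ν) :=
  inferInstanceAs (IsProbabilityMeasure (p.prod ν))

lemma condEntropy_singleLaw :
    condEntropy (singleLaw p ν) (fun ω => ω.1) singleOutput =
      (∑ b, negMulLog (p.real {b}) -
        symbolInfo (biasLaw ν) (∑ b, p.real {b} * bpsk b)) / log 2 := by
  set τ := ∑ b, p.real {b} * bpsk b with hτ
  have hsum (d : ℝ) : ∑ b, p.real {b} * (1 + bpsk b * d) = 1 + τ * d := by
    simp only [mul_add, mul_one, Finset.sum_add_distrib, ← mul_assoc, ← Finset.sum_mul,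
      sum_real_singleton, hτ]
  have hsymm := isSymmetricLaw_biasLaw ν
  have hterm (b : Bool) : ∫ d : Bias, negMulLog (p.real {b} * (1 + bpsk b * d)) ∂biasLaw ν =
      negMulLog (p.real {b}) + p.real {b} * (meanEntropy (biasLaw ν) - log 2) := by
    rw [hsymm.integral_negMulLog_mul_one_add_mul]
    simp only [signEntropy_bpsk_mul, meanEntropy]
  rw [(hasJointDensity_singleLaw p ν).condEntropy_eq]
  simp only [hsum]
  rw [← integral_biasLaw ν (f := fun d => ∑ b, negMulLog (p.real {b} * (1 + bpsk b * d)) -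
      negMulLog (1 + τ * d)) (by fun_prop), integral_sub
      (integrable_of_continuous _ (by fun_prop)) (integrable_of_continuous _ (by fun_prop)),
    integral_finsetSum _ fun b _ => integrable_of_continuous _ (by fun_prop),
    hsymm.integral_negMulLog_one_add_mul]
  simp only [hterm, Finset.sum_add_distrib, ← Finset.sum_mul, sum_real_singleton, symbolInfo]
  ring

lemma mutualInfo_singleLaw :
    mutualInfo (singleLaw p ν) (fun ω => ω.1) singleOutput =
      symbolInfo (biasLaw ν) (∑ b, p.real {b} * bpsk b) / log 2 := by
  rw [mutualInfo, entropy_singleLaw, condEntropy_singleLaw, ← sub_div, sub_sub_cancel]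

instance : IsProbabilityMeasure unifBit :=
  isProbabilityMeasure_uniformOn finite_univ univ_nonempty

lemma unifBit_real (b : Bool) : unifBit.real {b} = 1 / 2 := by
  rw [unifBit, measureReal_def, uniformOn_univ]
  simp

lemma sum_unifBit_mul_bpsk : ∑ b, unifBit.real {b} * bpsk b = 0 := by
  simp [unifBit_real, bpsk]

lemma chanEntropy_eq : chanEntropy ν = meanEntropy (biasLaw ν) / log 2 := by
  have hunif : ∑ b, negMulLog (unifBit.real {b}) = log 2 := by
    simp only [unifBit_real, Fintype.sum_bool, negMulLog, one_div, log_inv]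
    ring
  rw [chanEntropy, condEntropy_singleLaw, hunif, sum_unifBit_mul_bpsk, symbolInfo_zero,
    sub_sub_cancel]

lemma capacity_eq : capacity ν = 1 - chanEntropy ν := by
  have hlog : 0 < log 2 := log_pos one_lt_two
  have hle (p : ProbabilityMeasure Bool) :
      mutualInfo (singleLaw (p : Measure Bool) ν) (fun ω => ω.1) singleOutput ≤
        (log 2 - meanEntropy (biasLaw ν)) / log 2 := by
    rw [mutualInfo_singleLaw]
    exact div_le_div_of_nonneg_right (symbolInfo_le _) hlog.le
  have hunif : mutualInfo (singleLaw unifBit ν) (fun ω => ω.1) singleOutput =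
      (log 2 - meanEntropy (biasLaw ν)) / log 2 := by
    rw [mutualInfo_singleLaw, sum_unifBit_mul_bpsk, symbolInfo_zero]
  have hsup : capacity ν = (log 2 - meanEntropy (biasLaw ν)) / log 2 :=
    le_antisymm (ciSup_le hle) (hunif.ge.trans (le_ciSup (f := fun p : ProbabilityMeasure Bool =>
      mutualInfo (singleLaw (p : Measure Bool) ν) (fun ω => ω.1) singleOutput)
        ⟨_, forall_mem_range.2 hle⟩ ⟨unifBit, inferInstance⟩))
  rw [hsup, chanEntropy_eq, sub_div, div_self hlog.ne']

lemma chanMMSE_eq : chanMMSE ν = 1 - ∫ d : Bias, (d : ℝ) ^ 2 ∂biasLaw ν := by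
  have hsum (y : EReal) : ∑ b, unifBit.real {b} * (1 + bpsk b * (bias ν y : ℝ)) = 1 := by
    simp only [Fintype.sum_bool, unifBit_real, bpsk, if_true, Bool.false_eq_true, if_false]
    ring
  have hmean (y : EReal) : ∑ b, bpsk b * (unifBit.real {b} * (1 + bpsk b * (bias ν y : ℝ))) =
      bias ν y := by
    simp only [Fintype.sum_bool, unifBit_real, bpsk, if_true, Bool.false_eq_true, if_false]
    ring
  rw [chanMMSE, (hasJointDensity_singleLaw unifBit ν).mmse_eq bpsk_sq]
  simp only [estimator, hsum, hmean, one_mul, div_one]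
  rw [← integral_biasLaw ν (f := fun d => 1 - (d : ℝ) ^ 2) (by fun_prop),
    integral_sub (integrable_const _) (integrable_of_continuous _ (by fun_prop)), integral_const,
    probReal_univ, one_smul]

variable {ν}

lemma ae_abs_bias_eq_one (h : chanMMSE ν = 0) : ∀ᵐ d : Bias ∂biasLaw ν, |(d : ℝ)| = 1 := by
  have hzero : ∫ d : Bias, (1 - (d : ℝ) ^ 2) ∂biasLaw ν = 0 := by
    rw [integral_sub (integrable_const _) (integrable_of_continuous _ (by fun_prop)),
      integral_const, probReal_univ, one_smul, ← chanMMSE_eq, h]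
  have hnonneg (d : Bias) : 0 ≤ 1 - (d : ℝ) ^ 2 :=
    sub_nonneg.2 ((sq_le_one_iff_abs_le_one _).2 (abs_le.2 d.2))
  rw [integral_eq_zero_iff_of_nonneg hnonneg (integrable_of_continuous _ (by fun_prop))] at hzero
  filter_upwards [hzero] with d hd
  rw [Pi.zero_apply, sub_eq_zero, eq_comm, ← sq_abs] at hd
  exact (pow_eq_one_iff_of_nonneg (abs_nonneg _) two_ne_zero).1 hd

lemma ae_bias_eq_zero (h : chanMMSE ν = 1) : ∀ᵐ d : Bias ∂biasLaw ν, (d : ℝ) = 0 := by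
  have hnonneg (d : Bias) : 0 ≤ (d : ℝ) ^ 2 := sq_nonneg _
  rw [chanMMSE_eq, sub_eq_self,
    integral_eq_zero_iff_of_nonneg hnonneg (integrable_of_continuous _ (by fun_prop))] at h
  filter_upwards [h] with d hd
  exact sq_eq_zero_iff.1 hd

lemma chanEntropy_of_perfect (h : ∀ᵐ d : Bias ∂biasLaw ν, |(d : ℝ)| = 1) : chanEntropy ν = 0 := by
  have hzero := symbolInfo_of_perfect h 0
  rw [symbolInfo_zero, signEntropy_zero, sub_eq_self] at hzero
  rw [chanEntropy_eq, hzero, zero_div]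

lemma chanEntropy_of_uninformative (h : ∀ᵐ d : Bias ∂biasLaw ν, (d : ℝ) = 0) :
    chanEntropy ν = 1 := by
  have hconst : (fun d : Bias => signEntropy d) =ᵐ[biasLaw ν] fun _ => log 2 := by
    filter_upwards [h] with d hd
    rw [hd, signEntropy_zero]
  rw [chanEntropy_eq, meanEntropy, integral_congr_ae hconst, integral_const, probReal_univ,
    one_smul, div_self (log_pos one_lt_two).ne']

end SingleUse

section Transmission

lemma pi_withDensity {ι E : Type*} [Fintype ι] [MeasurableSpace E] (ρ : Measure E)
    [IsProbabilityMeasure ρ] {f : ι → E → ENNReal} (hf : ∀ j, Measurable (f j))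
    [∀ j, SigmaFinite (ρ.withDensity (f j))] :
    Measure.pi (fun j => ρ.withDensity (f j)) =
      (Measure.pi fun _ : ι => ρ).withDensity fun y => ∏ j, f j (y j) := by
  refine Measure.pi_eq fun s hs => ?_
  have hindicator (y : ι → E) : (univ.pi s).indicator (fun y => ∏ j, f j (y j)) y =
      ∏ j, (s j).indicator (f j) (y j) := by
    by_cases hy : ∀ j, y j ∈ s j
    · simp [indicator_of_mem, hy]
    · obtain ⟨j, hj⟩ := not_forall.1 hy
      rw [indicator_of_notMem (by simpa using ⟨j, hj⟩),
        Finset.prod_eq_zero (Finset.mem_univ j) (indicator_of_notMem hj _)]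
  have hmeas (j : ι) : Measurable ((s j).indicator (f j)) := (hf j).indicator (hs j)
  rw [withDensity_apply _ (MeasurableSet.univ_pi hs), ← lintegral_indicator
    (MeasurableSet.univ_pi hs), lintegral_congr hindicator,
    lintegral_prod_eq_prod_lintegral_of_indepFun Finset.univ
      (fun j (y : ι → E) => (s j).indicator (f j) (y j))
      (iIndepFun_pi fun j => (hmeas j).aemeasurable)
      fun j => (hmeas j).comp (measurable_pi_apply j)]
  refine Finset.prod_congr rfl fun j _ => ?_
  rw [withDensity_apply _ (hs j), ← lintegral_indicator (hs j),
    ← (measurePreserving_eval (fun _ : ι => ρ) j).lintegral_comp (hmeas j)]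

lemma measurePreserving_restrict_ne {ι E : Type*} [Fintype ι] [DecidableEq ι] [MeasurableSpace E]
    (ρ : Measure E) [IsProbabilityMeasure ρ] (i : ι) :
    MeasurePreserving (fun (y : ι → E) (j : {j // j ≠ i}) => y j) (Measure.pi fun _ => ρ)
      (Measure.pi fun _ => ρ) :=
  measurePreserving_fst.comp (measurePreserving_piEquivPiSubtypeProd (fun _ => ρ) fun j => j ≠ i)

variable {N : ℕ} (μ : Measure (Fin N → Bool)) (ν : Measure EReal) (i : Fin N)

/-- Extrinsic MMSE of the symbol `i` of a random word with law `μ`, sent through the channel of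
`ν`. -/
noncomputable def wordMMSE : ℝ :=
  mmse (μ.prod (Measure.pi fun _ => ν)) (fun ω => bpsk (ω.1 i)) (extrinsicOutput i)

variable [IsProbabilityMeasure ν]

lemma map_extrinsicOutput (x : Fin N → Bool) :
    (Measure.pi fun _ : Fin N => ν).map (fun z => extrinsicOutput i (x, z)) =
      (Measure.pi fun _ : {j // j ≠ i} => outLaw ν).withDensity fun y =>
        ENNReal.ofReal (∏ j : {j // j ≠ i}, (1 + bpsk (x j) * (bias ν (y j) : ℝ))) := by
  have hmeas : Measurable fun (y : {j // j ≠ i} → EReal) (j : {j // j ≠ i}) =>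
      output (x j) (y j) :=
    measurable_pi_lambda _ fun j => (measurable_output _).comp (measurable_pi_apply j)
  have hprob (j : {j // j ≠ i}) : IsProbabilityMeasure (ν.map (output (x j))) :=
    inferInstanceAs (IsProbabilityMeasure (transition ν (x j)))
  have hmap (j : {j // j ≠ i}) : ν.map (output (x j)) =
      (outLaw ν).withDensity fun y => ENNReal.ofReal (1 + bpsk (x j) * bias ν y) :=
    transition_eq ν (x j)
  change (Measure.pi fun _ : Fin N => ν).map
    ((fun (y : {j // j ≠ i} → EReal) (j : {j // j ≠ i}) => output (x j) (y j)) ∘ fun z j => z j) = _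
  rw [← Measure.map_map hmeas (measurePreserving_restrict_ne ν i).measurable,
    (measurePreserving_restrict_ne ν i).map_eq,
    Measure.pi_map_pi fun j => (measurable_output _).aemeasurable]
  simp only [hmap] at hprob ⊢
  rw [pi_withDensity (outLaw ν) fun j => by fun_prop]
  congr 1 with y
  rw [ENNReal.ofReal_prod_of_nonneg fun j _ => one_add_bpsk_mul_nonneg _ (bias ν (y j))]

lemma measurePreserving_bias_pi {ι : Type*} [Fintype ι] :
    MeasurePreserving (fun (y : ι → EReal) j => bias ν (y j)) (Measure.pi fun _ => outLaw ν)
      (Measure.pi fun _ => biasLaw ν) :=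
  measurePreserving_pi _ _ fun _ => ⟨measurable_bias ν, rfl⟩

variable [IsFiniteMeasure μ]

lemma hasJointDensity_extrinsicOutput :
    HasJointDensity (μ.prod (Measure.pi fun _ => ν)) (fun ω => ω.1) (extrinsicOutput i)
      (Measure.pi fun _ : {j // j ≠ i} => outLaw ν)
      (fun x y => μ.real {x} * ∏ j : {j // j ≠ i}, (1 + bpsk (x j) * (bias ν (y j) : ℝ))) :=
  hasJointDensity_prod μ _ _ (F := fun x z => extrinsicOutput i (x, z))
    (fun x => measurable_pi_lambda _ fun j => (measurable_output _).comp (measurable_pi_apply _))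
    (fun x => by fun_prop)
    (fun x y => Finset.prod_nonneg fun j _ => one_add_bpsk_mul_nonneg _ (bias ν (y j)))
    (map_extrinsicOutput ν i)

lemma wordMMSE_eq_blockMMSE : wordMMSE μ ν i = blockMMSE μ i (fun _ => biasLaw ν) := by
  have hdensity := hasJointDensity_extrinsicOutput μ ν i
  have hlikelihood (x : Fin N → Bool) (y : Fin N → EReal) :
      ∏ j : {j // j ≠ i}, (1 + bpsk (x j) * (bias ν (y j) : ℝ)) =
        likelihood (Finset.univ.erase i) x fun j => bias ν (y j) :=
    (Finset.prod_subtype (Finset.univ.erase i) (by simp)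
      fun j => 1 + bpsk (x j) * (bias ν (y j) : ℝ)).symm
  have hmeas := (Finset.measurable_fun_sum Finset.univ fun x _ =>
    hdensity.measurable_density x).fun_mul (((measurable_estimator hdensity.measurable_density
      fun x => bpsk (x i)).pow_const 2).const_sub 1)
  have hpres := measurePreserving_restrict_ne (outLaw ν) i
  rw [wordMMSE, hdensity.mmse_eq (φ := fun x => bpsk (x i)) fun x => bpsk_sq (x i), blockMMSE,
    ← (measurePreserving_bias_pi ν).map_eq,
    integral_map (measurePreserving_bias_pi ν).measurable.aemeasurable
      (continuous_errDensity μ _ i).aestronglyMeasurable,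
    ← hpres.map_eq, integral_map hpres.measurable.aemeasurable hmeas.aestronglyMeasurable]
  congr 1 with y
  simp only [estimator, hlikelihood, errDensity, postMean, evidence, evidenceMean]
  simp only [mul_comm (bpsk _)]

end Transmission

/-! ### Monotone functions and their derivatives -/

section RealAnalysis

lemma mul_deriv_le_deriv {f g : ℝ → ℝ} {c x : ℝ} (hf : DifferentiableAt ℝ f x)
    (hg : DifferentiableAt ℝ g x)
    (h : ∀ᶠ y in nhdsWithin x (Ioi x), c * (f y - f x) ≤ g y - g x) :
    c * deriv f x ≤ deriv g x := by
  have hle : nhdsWithin x (Ioi x) ≤ nhdsWithin x {x}ᶜ :=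
    nhdsWithin_mono _ fun _ hy => ne_of_gt hy
  refine le_of_tendsto_of_tendsto ((hf.hasDerivAt.tendsto_slope.mono_left hle).const_mul c)
    (hg.hasDerivAt.tendsto_slope.mono_left hle) ?_
  filter_upwards [h, self_mem_nhdsWithin] with y hy hxy
  rw [slope_def_field, slope_def_field, ← mul_div_assoc]
  exact div_le_div_of_nonneg_right hy (sub_nonneg.2 (le_of_lt hxy))

lemma ofReal_integral_mul_le {α : Type*} [MeasurableSpace α] {μ : Measure α} {g φ : α → ℝ}
    {κ : ENNReal} (hg : Integrable g μ) (hnonneg : 0 ≤ᵐ[μ] g)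
    (hgφ : Integrable (fun s => g s * φ s) μ) (hφ : ∀ᵐ s ∂μ, ENNReal.ofReal (φ s) ≤ κ) :
    ENNReal.ofReal (∫ s, g s * φ s ∂μ) ≤ κ * ENNReal.ofReal (∫ s, g s ∂μ) := by
  calc ENNReal.ofReal (∫ s, g s * φ s ∂μ)
      ≤ ∫⁻ s, ENNReal.ofReal (g s * φ s) ∂μ := by
        refine ENNReal.ofReal_le_of_le_toReal ?_
        rw [integral_eq_lintegral_pos_part_sub_lintegral_neg_part hgφ]
        exact sub_le_self _ ENNReal.toReal_nonneg
    _ ≤ ∫⁻ s, κ * ENNReal.ofReal (g s) ∂μ := by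
        refine lintegral_mono_ae ?_
        filter_upwards [hnonneg, hφ] with s hgs hφs
        rw [ENNReal.ofReal_mul hgs, mul_comm κ]
        gcongr
    _ = κ * ENNReal.ofReal (∫ s, g s ∂μ) := by
        rw [lintegral_const_mul'' κ hg.aemeasurable.ennreal_ofReal,
          ofReal_integral_eq_lintegral_ofReal hg hnonneg]

variable {a b : ℝ} {m φ : ℝ → ℝ}

lemma intervalIntegrable_mul_of_monotoneOn (hm : MonotoneOn m (uIcc a b))
    (hφ : IntervalIntegrable φ volume a b) :
    IntervalIntegrable (fun s => m s * φ s) volume a b := by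
  have hbound : ∀ᵐ s ∂volume.restrict (uIoc a b), ‖m s‖ ≤ max |m (min a b)| |m (max a b)| := by
    filter_upwards [ae_restrict_mem measurableSet_uIoc] with s hs
    have hs' : s ∈ uIcc a b := uIoc_subset_uIcc hs
    exact abs_le_max_abs_abs (hm ⟨le_rfl, min_le_max⟩ hs' hs'.1) (hm hs' ⟨min_le_max, le_rfl⟩ hs'.2)
  rw [intervalIntegrable_iff] at hφ ⊢
  exact hφ.bdd_mul hm.intervalIntegrable.def'.aestronglyMeasurable hbound

lemma intervalIntegrable_mul_one_sub_mul (hm : MonotoneOn m (uIcc a b))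
    (hφ : IntervalIntegrable φ volume a b) :
    IntervalIntegrable (fun s => m s * (1 - m s) * φ s) volume a b := by
  have hmφ := intervalIntegrable_mul_of_monotoneOn hm hφ
  refine (hmφ.sub (intervalIntegrable_mul_of_monotoneOn hm hmφ)).congr fun s _ => ?_
  ring

lemma integral_mul_deriv_le_sub {f g : ℝ → ℝ} (hab : a ≤ b) (hm : MonotoneOn m (Icc a b))
    (hf : MonotoneOn f (Icc a b)) (hg : MonotoneOn g (Icc a b))
    (h : ∀ x ∈ Icc a b, ∀ y ∈ Icc a b, x ≤ y → m x * (f y - f x) ≤ g y - g x) :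
    ∫ s in a..b, m s * deriv f s ≤ g b - g a := by
  have hderiv : ∀ᵐ s, s ∈ Ioo a b → m s * deriv f s ≤ deriv g s := by
    filter_upwards [hf.ae_differentiableWithinAt_of_mem, hg.ae_differentiableWithinAt_of_mem]
      with s hfs hgs hs
    have hmem := Icc_mem_nhds hs.1 hs.2
    have hs' := Ioo_subset_Icc_self hs
    refine mul_deriv_le_deriv ((hfs hs').differentiableAt hmem) ((hgs hs').differentiableAt hmem) ?_
    filter_upwards [nhdsWithin_le_nhds hmem, self_mem_nhdsWithin] with y hy hsy
    exact h s hs' y hy (le_of_lt hsy)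
  rw [← uIcc_of_le hab] at hm hf hg
  refine (intervalIntegral.integral_mono_ae_restrict hab
    (intervalIntegrable_mul_of_monotoneOn hm hf.intervalIntegrable_deriv)
    hg.intervalIntegrable_deriv ?_).trans ?_
  · rw [← restrict_Ioo_eq_restrict_Icc]
    exact (ae_restrict_iff' measurableSet_Ioo).2 hderiv
  · have hgab := hg left_mem_uIcc right_mem_uIcc hab
    exact (uIcc_of_le (sub_nonneg.2 hgab) ▸ hg.intervalIntegral_deriv_mem_uIcc).2

end RealAnalysis

/-! ### Words sent through a channel -/

section CondRate

variable {N : ℕ} (μ : Measure (Fin N → Bool)) {ν ν' : Measure EReal}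

/-- Conditional entropy, in bits per symbol, of a random word with law `μ` given its observation
through the channel of `ν`. -/
noncomputable def condRate (μ : Measure (Fin N → Bool)) (ν : Measure EReal) : ℝ :=
  blockEntropy μ (fun _ => biasLaw ν) / (N * log 2)

variable [IsProbabilityMeasure ν] [IsProbabilityMeasure ν']

lemma IsDegraded.chanEntropy_le (h : IsDegraded ν' ν) : chanEntropy ν ≤ chanEntropy ν' := by
  rw [chanEntropy_eq, chanEntropy_eq]
  exact div_le_div_of_nonneg_right h.convexDominates.meanEntropy_le (log_pos one_lt_two).le

lemma IsDegraded.chanEntropy_lt (h : IsDegraded ν' ν) (hlt : chanMMSE ν < chanMMSE ν') :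
    chanEntropy ν < chanEntropy ν' := by
  have hsplit (m : Measure Bias) [IsProbabilityMeasure m] :
      ∫ d : Bias, (signEntropy d + (d : ℝ) ^ 2 / 2) ∂m =
        meanEntropy m + (∫ d : Bias, (d : ℝ) ^ 2 ∂m) / 2 := by
    rw [integral_add (integrable_of_continuous _ (by fun_prop))
      (integrable_of_continuous _ (by fun_prop)), integral_div, meanEntropy]
  have hconcave := h.convexDominates _ concaveOn_signEntropy_add_sq
    (Continuous.continuousOn (by fun_prop))
  rw [hsplit, hsplit] at hconcave
  rw [chanMMSE_eq, chanMMSE_eq] at hlt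
  rw [chanEntropy_eq, chanEntropy_eq]
  exact div_lt_div_of_pos_right (by linarith) (log_pos one_lt_two)

lemma IsDegraded.condRate_le (h : IsDegraded ν' ν) : condRate μ ν ≤ condRate μ ν' := by
  have hsum := sum_blockMMSE_mul_le_blockEntropy_sub μ (fun _ : Fin N => isSymmetricLaw_biasLaw ν)
    (fun _ => isSymmetricLaw_biasLaw ν') fun _ => h.convexDominates
  have hnonneg := hsum.trans' (Finset.sum_nonneg fun j _ =>
    mul_nonneg (blockMMSE_nonneg μ j _) (sub_nonneg.2 h.convexDominates.meanEntropy_le))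
  exact div_le_div_of_nonneg_right (sub_nonneg.1 hnonneg)
    (mul_nonneg N.cast_nonneg (log_pos one_lt_two).le)

variable [IsProbabilityMeasure μ]

section Word

variable (i : Fin N)

lemma wordMMSE_mem_Icc : wordMMSE μ ν i ∈ Icc (0 : ℝ) 1 := by
  rw [wordMMSE_eq_blockMMSE]
  exact ⟨blockMMSE_nonneg μ i _, blockMMSE_le_one μ i fun _ => isSymmetricLaw_biasLaw ν⟩

lemma IsDegraded.wordMMSE_le (h : IsDegraded ν' ν) : wordMMSE μ ν i ≤ wordMMSE μ ν' i := by
  rw [wordMMSE_eq_blockMMSE, wordMMSE_eq_blockMMSE]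
  exact blockMMSE_mono μ i fun _ => h.convexDominates

variable {μ}

lemma HasTransitiveSymmetry.wordMMSE_mul_le_condRate_sub (hμ : HasTransitiveSymmetry μ)
    (h : IsDegraded ν' ν) :
    wordMMSE μ ν i * (chanEntropy ν' - chanEntropy ν) ≤ condRate μ ν' - condRate μ ν := by
  have hN : (0 : ℝ) < N := Nat.cast_pos.2 i.pos
  have hsum := sum_blockMMSE_mul_le_blockEntropy_sub μ (fun _ : Fin N => isSymmetricLaw_biasLaw ν)
    (fun _ => isSymmetricLaw_biasLaw ν') fun _ => h.convexDominates
  simp only [hμ.blockMMSE_eq i, ← wordMMSE_eq_blockMMSE, Finset.sum_const, Finset.card_univ,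
    Fintype.card_fin, nsmul_eq_mul] at hsum
  rw [condRate, condRate, ← sub_div, le_div_iff₀ (by positivity), chanEntropy_eq, chanEntropy_eq]
  refine hsum.trans_eq' ?_
  field_simp

lemma HasTransitiveSymmetry.condRate_le_signEntropy (hμ : HasTransitiveSymmetry μ)
    (h : IsDegraded ν' ν)
    (hperfect : ∀ᵐ d : Bias ∂biasLaw ν, |(d : ℝ)| = 1) :
    condRate μ ν' ≤ signEntropy (√(1 - wordMMSE μ ν' i)) / log 2 := by
  have hlog : 0 < log 2 := log_pos one_lt_two
  have hN : (0 : ℝ) < N := Nat.cast_pos.2 i.pos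
  have hsum := blockEntropy_sub_le_sum_of_perfect μ
    (fun _ : Fin N => isSymmetricLaw_biasLaw ν) (fun _ => isSymmetricLaw_biasLaw ν')
    (fun _ => h.convexDominates) fun _ => hperfect
  simp only [blockEntropy_of_perfect μ fun _ => hperfect, sub_zero, hμ.blockMMSE_eq i,
    ← wordMMSE_eq_blockMMSE, Finset.sum_const, Finset.card_univ, Fintype.card_fin,
    nsmul_eq_mul] at hsum
  rw [condRate, div_le_div_iff₀ (by positivity) hlog]
  refine (mul_le_mul_of_nonneg_right hsum hlog.le).trans_eq ?_
  ring

end Word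

lemma IsDegraded.condRate_sub_le (h : IsDegraded ν' ν) (hN : 0 < N) :
    condRate μ ν' - condRate μ ν ≤ chanEntropy ν' - chanEntropy ν := by
  have hsum := blockEntropy_sub_le_sum μ (fun _ : Fin N => isSymmetricLaw_biasLaw ν)
    (fun _ => isSymmetricLaw_biasLaw ν') fun _ => h.convexDominates
  simp only [Finset.sum_const, Finset.card_univ, Fintype.card_fin, nsmul_eq_mul] at hsum
  rw [condRate, condRate, ← sub_div, div_le_iff₀ (by positivity), chanEntropy_eq, chanEntropy_eq]
  refine hsum.trans_eq ?_
  field_simp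

lemma condRate_of_perfect (μ : Measure (Fin N → Bool))
    (h : ∀ᵐ d : Bias ∂biasLaw ν, |(d : ℝ)| = 1) : condRate μ ν = 0 := by
  rw [condRate, blockEntropy_of_perfect μ fun _ => h, zero_div]

lemma condRate_of_uninformative (h : ∀ᵐ d : Bias ∂biasLaw ν, (d : ℝ) = 0) :
    condRate μ ν = entropy μ id / N := by
  rw [condRate, blockEntropy_of_uninformative μ fun _ => h, mul_comm, ← div_div]
  rfl

end CondRate

lemma ofReal_deriv_chanEntropy_le_kappa (ν : ℝ → Measure EReal) {t s : ℝ} (ht : 0 ≤ t)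
    (hs : s ∈ Ioo t 1) : ENNReal.ofReal (deriv (fun u => chanEntropy (ν u)) s) ≤ kappa ν t := by
  rw [← derivWithin_of_mem_nhds (Icc_mem_nhds (ht.trans_lt hs.1) hs.2)]
  exact le_iSup₂ (f := fun s (_ : s ∈ Icc t 1) =>
    ENNReal.ofReal (derivWithin (fun u => chanEntropy (ν u)) (Icc 0 1) s)) s
      (Ioo_subset_Icc_self hs)

namespace IsAdmissibleFamily

variable {ν : ℝ → Measure EReal} [∀ t, IsProbabilityMeasure (ν t)]

section Capacity

lemma ae_perfect (hν : IsAdmissibleFamily ν) : ∀ᵐ d : Bias ∂biasLaw (ν 0), |(d : ℝ)| = 1 :=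
  ae_abs_bias_eq_one (hν.mmse_eq 0 (left_mem_Icc.2 zero_le_one))

lemma ae_uninformative (hν : IsAdmissibleFamily ν) : ∀ᵐ d : Bias ∂biasLaw (ν 1), (d : ℝ) = 0 :=
  ae_bias_eq_zero (hν.mmse_eq 1 (right_mem_Icc.2 zero_le_one))

lemma capacity_zero (hν : IsAdmissibleFamily ν) : capacity (ν 0) = 1 := by
  rw [capacity_eq, chanEntropy_of_perfect hν.ae_perfect, sub_zero]

lemma capacity_one (hν : IsAdmissibleFamily ν) : capacity (ν 1) = 0 := by
  rw [capacity_eq, chanEntropy_of_uninformative hν.ae_uninformative, sub_self]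

lemma monotoneOn_chanEntropy (hν : IsAdmissibleFamily ν) :
    MonotoneOn (fun t => chanEntropy (ν t)) (Icc 0 1) :=
  fun s hs t ht hst => (hν.degraded s t hs.1 hst ht.2).chanEntropy_le

lemma strictAntiOn_capacity (hν : IsAdmissibleFamily ν) :
    StrictAntiOn (fun t => capacity (ν t)) (Icc 0 1) := by
  intro s hs t ht hst
  have hlt := (hν.degraded s t hs.1 hst.le ht.2).chanEntropy_lt
    (by rwa [hν.mmse_eq s hs, hν.mmse_eq t ht])
  simp only [capacity_eq]
  exact sub_lt_sub_left hlt 1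

lemma continuousOn_capacity (hν : IsAdmissibleFamily ν) :
    ContinuousOn (fun t => capacity (ν t)) (Icc 0 1) := by
  have hcont := hν.absolutelyContinuous.continuousOn
  rw [uIcc_of_le zero_le_one] at hcont
  simp only [capacity_eq]
  exact continuousOn_const.sub hcont

lemma surjOn_capacity (hν : IsAdmissibleFamily ν) :
    SurjOn (fun t => capacity (ν t)) (Icc 0 1) (Icc 0 1) := by
  have hsurj := intermediate_value_Icc' zero_le_one hν.continuousOn_capacity
  rwa [hν.capacity_zero, hν.capacity_one] at hsurj

variable {r s t : ℝ}

lemma capacity_sub_capacity_mem_Icc (hν : IsAdmissibleFamily ν) (hr : 0 ≤ r) (hrs : r ≤ s)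
    (hs : s ≤ 1) :
    capacity (ν r) - capacity (ν s) ∈ Icc (0 : ℝ) 1 := by
  have hanti := hν.strictAntiOn_capacity.antitoneOn
  have h0r := hanti (left_mem_Icc.2 zero_le_one) ⟨hr, hrs.trans hs⟩ hr
  have hrs' := hanti ⟨hr, hrs.trans hs⟩ ⟨hr.trans hrs, hs⟩ hrs
  have hs1 := hanti ⟨hr.trans hrs, hs⟩ (right_mem_Icc.2 zero_le_one) hs
  simp only [hν.capacity_zero, hν.capacity_one] at h0r hrs' hs1
  constructor <;> linarith

lemma intervalIntegrable_psi (hν : IsAdmissibleFamily ν) (hr : 0 ≤ r) (hrt : r ≤ t) (ht : t ≤ 1) :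
    IntervalIntegrable (fun s => psi (capacity (ν r) - capacity (ν s))) volume r t := by
  refine MonotoneOn.intervalIntegrable fun x hx y hy hxy => ?_
  rw [uIcc_of_le hrt] at hx hy
  refine strictMonoOn_psi.monotoneOn (hν.capacity_sub_capacity_mem_Icc hr hx.1 (hx.2.trans ht))
    (hν.capacity_sub_capacity_mem_Icc hr hy.1 (hy.2.trans ht)) (sub_le_sub_left ?_ _)
  exact hν.strictAntiOn_capacity.antitoneOn ⟨hr.trans hx.1, hx.2.trans ht⟩
    ⟨hr.trans hy.1, hy.2.trans ht⟩ hxy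

lemma integral_psi_pos (hν : IsAdmissibleFamily ν) (hr : 0 ≤ r) (hrt : r < t) (ht : t ≤ 1) :
    0 < ∫ s in r..t, psi (capacity (ν r) - capacity (ν s)) := by
  refine intervalIntegral.intervalIntegral_pos_of_pos_on (hν.intervalIntegrable_psi hr hrt.le ht)
    (fun s hs => ?_) hrt
  have hs1 := hs.2.le.trans ht
  have hlt := hν.strictAntiOn_capacity ⟨hr, hs.1.le.trans hs1⟩ ⟨hr.trans hs.1.le, hs1⟩ hs.1
  exact (psi_nonneg (left_mem_Icc.2 zero_le_one)).trans_lt (strictMonoOn_psi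
    (left_mem_Icc.2 zero_le_one) (hν.capacity_sub_capacity_mem_Icc hr hs.1.le hs1) (sub_pos.2 hlt))

lemma integral_deriv_chanEntropy (hν : IsAdmissibleFamily ν) (ht : t ∈ Icc (0 : ℝ) 1) :
    ∫ s in t..1, deriv (fun u => chanEntropy (ν u)) s = capacity (ν t) := by
  have hac := hν.absolutelyContinuous.mono (c := t) (d := 1) (by
    rw [uIcc_of_le ht.2, uIcc_of_le zero_le_one]
    exact Icc_subset_Icc_left ht.1)
  rw [hac.integral_deriv_eq_sub, chanEntropy_of_uninformative hν.ae_uninformative, capacity_eq]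

end Capacity

section Word

variable {N : ℕ} (μ : Measure (Fin N → Bool)) [IsProbabilityMeasure μ] (i : Fin N)

lemma monotoneOn_wordMMSE (hν : IsAdmissibleFamily ν) :
    MonotoneOn (fun t => wordMMSE μ (ν t) i) (Icc 0 1) :=
  fun s hs t ht hst => (hν.degraded s t hs.1 hst ht.2).wordMMSE_le μ i

lemma intervalIntegrable_wordMMSE_mul_one_sub (hν : IsAdmissibleFamily ν) {a b : ℝ} (ha : 0 ≤ a)
    (hab : a ≤ b) (hb : b ≤ 1) :
    IntervalIntegrable (fun s => wordMMSE μ (ν s) i * (1 - wordMMSE μ (ν s) i)) volume a b := by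
  have hmono := (hν.monotoneOn_wordMMSE μ i).mono (Icc_subset_Icc ha hb)
  rw [← uIcc_of_le hab] at hmono
  simpa only [mul_one] using
    intervalIntegrable_mul_one_sub_mul hmono (intervalIntegrable_const (c := (1 : ℝ)))

variable {μ} {r t : ℝ}

lemma integral_wordMMSE_mul_deriv_le (hν : IsAdmissibleFamily ν) (hμ : HasTransitiveSymmetry μ)
    (ht : t ∈ Icc (0 : ℝ) 1) :
    ∫ s in t..1, wordMMSE μ (ν s) i * deriv (fun u => chanEntropy (ν u)) s ≤ entropy μ id / N := by
  have hsub : Icc t 1 ⊆ Icc (0 : ℝ) 1 := Icc_subset_Icc_left ht.1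
  have hnonneg : 0 ≤ condRate μ (ν t) := by
    rw [← condRate_of_perfect μ hν.ae_perfect]
    exact (hν.degraded 0 t le_rfl ht.1 ht.2).condRate_le μ
  have hle := integral_mul_deriv_le_sub (g := fun s => condRate μ (ν s)) ht.2
    ((hν.monotoneOn_wordMMSE μ i).mono hsub) (hν.monotoneOn_chanEntropy.mono hsub)
    (fun x hx y hy hxy => (hν.degraded x y (hsub hx).1 hxy hy.2).condRate_le μ)
    fun x hx y hy hxy => hμ.wordMMSE_mul_le_condRate_sub i (hν.degraded x y (hsub hx).1 hxy hy.2)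
  rw [condRate_of_uninformative μ hν.ae_uninformative] at hle
  linarith

lemma wordMMSE_mul_capacity_sub_le (hν : IsAdmissibleFamily ν) (hμ : HasTransitiveSymmetry μ)
    (ht : t ∈ Icc (0 : ℝ) 1) :
    wordMMSE μ (ν t) i * (capacity (ν t) - entropy μ id / N) ≤
      ∫ s in t..1, wordMMSE μ (ν s) i * (1 - wordMMSE μ (ν s) i) *
        deriv (fun u => chanEntropy (ν u)) s := by
  set m := fun s => wordMMSE μ (ν s) i
  set h := fun u => chanEntropy (ν u)
  have hsub : Icc t 1 ⊆ Icc (0 : ℝ) 1 := Icc_subset_Icc_left ht.1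
  have hm : MonotoneOn m (Icc t 1) := (hν.monotoneOn_wordMMSE μ i).mono hsub
  have hh : MonotoneOn h (Icc t 1) := hν.monotoneOn_chanEntropy.mono hsub
  rw [← uIcc_of_le ht.2] at hm hh
  have hint := hh.intervalIntegrable_deriv
  have hmint := intervalIntegrable_mul_of_monotoneOn hm hint
  calc m t * (capacity (ν t) - entropy μ id / N)
      ≤ m t * ∫ s in t..1, (deriv h s - m s * deriv h s) := by
        rw [intervalIntegral.integral_sub hint hmint, hν.integral_deriv_chanEntropy ht]
        exact mul_le_mul_of_nonneg_left (sub_le_sub_left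
          (hν.integral_wordMMSE_mul_deriv_le i hμ ht) _) (wordMMSE_mem_Icc μ i).1
    _ = ∫ s in t..1, m t * (deriv h s - m s * deriv h s) :=
        (intervalIntegral.integral_const_mul _ _).symm
    _ ≤ ∫ s in t..1, m s * (1 - m s) * deriv h s := by
        refine intervalIntegral.integral_mono_on_of_le_Ioo ht.2 ((hint.sub hmint).const_mul _)
          (intervalIntegrable_mul_one_sub_mul hm hint) fun s hs => ?_
        have hderiv : 0 ≤ deriv h s := by
          rw [uIcc_of_le ht.2] at hh
          rw [← derivWithin_of_mem_nhds (Icc_mem_nhds hs.1 hs.2)]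
          exact hh.derivWithin_nonneg
        have hmono : m t ≤ m s :=
          hν.monotoneOn_wordMMSE μ i ht (hsub (Ioo_subset_Icc_self hs)) hs.1.le
        have hle : m s ≤ 1 := (wordMMSE_mem_Icc μ i).2
        nlinarith [mul_nonneg (mul_nonneg (sub_nonneg.2 hmono) (sub_nonneg.2 hle)) hderiv]

lemma ofReal_wordMMSE_mul_le (hν : IsAdmissibleFamily ν) (hμ : HasTransitiveSymmetry μ)
    (ht : t ∈ Icc (0 : ℝ) 1) :
    ENNReal.ofReal (wordMMSE μ (ν t) i * (capacity (ν t) - entropy μ id / N)) ≤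
      kappa ν t *
        ENNReal.ofReal (∫ s in t..1, wordMMSE μ (ν s) i * (1 - wordMMSE μ (ν s) i)) := by
  refine (ENNReal.ofReal_le_ofReal (hν.wordMMSE_mul_capacity_sub_le i hμ ht)).trans ?_
  have hsub : Icc t 1 ⊆ Icc (0 : ℝ) 1 := Icc_subset_Icc_left ht.1
  have hm := (hν.monotoneOn_wordMMSE μ i).mono hsub
  have hh := hν.monotoneOn_chanEntropy.mono hsub
  rw [← uIcc_of_le ht.2] at hm hh
  have hint := hν.intervalIntegrable_wordMMSE_mul_one_sub μ i ht.1 ht.2 le_rfl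
  have hint' := intervalIntegrable_mul_one_sub_mul hm hh.intervalIntegrable_deriv
  rw [intervalIntegral.integral_of_le ht.2, intervalIntegral.integral_of_le ht.2]
  refine ofReal_integral_mul_le hint.1 (ae_of_all _ fun s => mul_nonneg (wordMMSE_mem_Icc μ i).1
    (sub_nonneg.2 (wordMMSE_mem_Icc μ i).2)) hint'.1 ?_
  rw [← restrict_Ioo_eq_restrict_Ioc]
  filter_upwards [ae_restrict_mem measurableSet_Ioo] with s hs
  exact ofReal_deriv_chanEntropy_le_kappa ν ht.1 hs

lemma psi_le_wordMMSE (hν : IsAdmissibleFamily ν) (hμ : HasTransitiveSymmetry μ)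
    (ht : t ∈ Icc (0 : ℝ) 1) (hcap : capacity (ν t) ≤ entropy μ id / N) :
    psi (entropy μ id / N - capacity (ν t)) ≤ wordMMSE μ (ν t) i := by
  have hlog : 0 < log 2 := log_pos one_lt_two
  have hm : wordMMSE μ (ν t) i ∈ Icc (0 : ℝ) 1 := wordMMSE_mem_Icc μ i
  have hfano : entropy μ id / N - capacity (ν t) ≤
      signEntropy (√(1 - wordMMSE μ (ν t) i)) / log 2 := by
    have hupper := hμ.condRate_le_signEntropy i (hν.degraded 0 t le_rfl ht.1 ht.2) hν.ae_perfect
    have hlower := (hν.degraded t 1 ht.1 ht.2 le_rfl).condRate_sub_le μ i.pos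
    rw [condRate_of_uninformative μ hν.ae_uninformative,
      chanEntropy_of_uninformative hν.ae_uninformative, ← capacity_eq] at hlower
    linarith
  have hle : signEntropy (√(1 - wordMMSE μ (ν t) i)) / log 2 ≤ 1 :=
    (div_le_one hlog).2 (signEntropy_le_log_two _)
  have hnonneg := sub_nonneg.2 hcap
  rw [← psi_signEntropy_sqrt hm]
  exact strictMonoOn_psi.monotoneOn ⟨hnonneg, hfano.trans hle⟩ ⟨hnonneg.trans hfano, hle⟩ hfano

lemma one_sub_wordMMSE_mul_integral_psi_le (hν : IsAdmissibleFamily ν)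
    (hμ : HasTransitiveSymmetry μ) (hr : 0 ≤ r) (hrt : r ≤ t) (ht : t ≤ 1)
    (hcap : capacity (ν r) = entropy μ id / N) :
    (1 - wordMMSE μ (ν t) i) * ∫ s in r..t, psi (capacity (ν r) - capacity (ν s)) ≤
      ∫ s in r..t, wordMMSE μ (ν s) i * (1 - wordMMSE μ (ν s) i) := by
  rw [← intervalIntegral.integral_const_mul]
  refine intervalIntegral.integral_mono_on hrt
    ((hν.intervalIntegrable_psi hr hrt ht).const_mul _)
    (hν.intervalIntegrable_wordMMSE_mul_one_sub μ i hr hrt ht) fun s hs => ?_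
  have hs' : s ∈ Icc (0 : ℝ) 1 := ⟨hr.trans hs.1, hs.2.trans ht⟩
  have hpsi : psi (capacity (ν r) - capacity (ν s)) ≤ wordMMSE μ (ν s) i := by
    rw [hcap]
    refine hν.psi_le_wordMMSE i hμ hs' (hcap ▸ ?_)
    exact sub_nonneg.1 (hν.capacity_sub_capacity_mem_Icc hr hs.1 hs'.2).1
  have hmono := hν.monotoneOn_wordMMSE μ i hs' ⟨hr.trans hrt, ht⟩ hs.2
  rw [mul_comm]
  exact mul_le_mul hpsi (sub_le_sub_left hmono 1) (sub_nonneg.2 (wordMMSE_mem_Icc μ i).2)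
    (wordMMSE_mem_Icc μ i).1

end Word

end IsAdmissibleFamily

lemma entropy_uniformOn {A : Type*} [Fintype A] [MeasurableSpace A] [MeasurableSingletonClass A]
    {s : Finset A} (hs : s.Nonempty) : entropy (uniformOn (s : Set A)) id = logb 2 s.card := by
  classical
  have hcard : (s.card : ℝ) ≠ 0 := Nat.cast_ne_zero.2 hs.card_ne_zero
  have hreal (a : A) : (uniformOn (s : Set A)).real {a} = if a ∈ s then (s.card : ℝ)⁻¹ else 0 := by
    rw [measureReal_def, ← Finset.coe_singleton, uniformOn_apply_finset]
    by_cases ha : a ∈ s <;> simp [ha]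
  have hsum : ∑ a, negMulLog ((uniformOn (s : Set A)).real {a}) = log s.card := by
    simp only [hreal, apply_ite negMulLog, negMulLog_zero, Finset.sum_ite_mem, Finset.univ_inter,
      Finset.sum_const, nsmul_eq_mul]
    rw [negMulLog, log_inv, neg_mul_neg, mul_inv_cancel_left₀ hcard]
  exact congrArg (· / log 2) hsum

section Word

variable {N : ℕ}

lemma entropy_div_mem_Icc (hN : 0 < N) (μ : Measure (Fin N → Bool)) [IsProbabilityMeasure μ] :
    entropy μ id / N ∈ Icc (0 : ℝ) 1 := by
  have hle := entropy_id_le_logb_card μ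
  rw [Fintype.card_fun, Fintype.card_bool, Fintype.card_fin, Nat.cast_pow, Nat.cast_ofNat,
    logb_pow, logb_self_eq_one one_lt_two, mul_one] at hle
  exact ⟨div_nonneg (entropy_id_nonneg μ) N.cast_nonneg, (div_le_one (Nat.cast_pos.2 hN)).2 hle⟩

variable {C : Finset (Fin N → Bool)}

lemma isProbabilityMeasure_codeLaw (hC : C.Nonempty) : IsProbabilityMeasure (codeLaw C) :=
  isProbabilityMeasure_uniformOn C.finite_toSet hC

lemma rate_eq_entropy_codeLaw_div (hC : C.Nonempty) : rate C = entropy (codeLaw C) id / N := by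
  rw [codeLaw, entropy_uniformOn hC, rate]

end Word

end BMS

theorem mainTheorem5_general (ν : ℝ → MeasureTheory.Measure EReal)
    [∀ t, MeasureTheory.IsProbabilityMeasure (ν t)] (hν : BMS.IsAdmissibleFamily ν)
    (N : ℕ) (hN : 0 < N) (μ : MeasureTheory.Measure (Fin N → Bool))
    [MeasureTheory.IsProbabilityMeasure μ] (hμ : BMS.HasTransitiveSymmetry μ) (R : ℝ)
    (hR : R = BMS.entropy μ id / N) :
    (∀ u ∈ Set.Icc (0 : ℝ) 1, 0 ≤ BMS.psi u) ∧ StrictMonoOn BMS.psi (Set.Icc 0 1) ∧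
    ∃ tR ∈ Set.Icc (0 : ℝ) 1,
      BMS.capacity (ν tR) = R ∧
      (∀ t ∈ Set.Icc (0 : ℝ) 1, BMS.capacity (ν t) = R → t = tR) ∧
      (0 < R → R < 1 → tR ∈ Set.Ioo (0 : ℝ) 1) ∧
      (∀ t ∈ Set.Ico 0 tR, R < BMS.capacity (ν t)) ∧
      (∀ t ∈ Set.Ioc tR 1, 0 < ∫ s in tR..t, BMS.psi (R - BMS.capacity (ν s))) ∧
      ∀ i : Fin N,
        IntervalIntegrable
          (fun s => BMS.wordMMSE μ (ν s) i * (1 - BMS.wordMMSE μ (ν s) i))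
          MeasureTheory.volume 0 1 ∧
        (∀ t ∈ Set.Ico 0 tR,
          ENNReal.ofReal (BMS.wordMMSE μ (ν t) i) ≤
            BMS.kappa ν t *
              ENNReal.ofReal (∫ s in t..1,
                BMS.wordMMSE μ (ν s) i * (1 - BMS.wordMMSE μ (ν s) i)) /
              ENNReal.ofReal (BMS.capacity (ν t) - R)) ∧
        (∀ t ∈ Set.Ioc tR 1,
          1 - (∫ s in tR..t,
                BMS.wordMMSE μ (ν s) i * (1 - BMS.wordMMSE μ (ν s) i)) /
              (∫ s in tR..t, BMS.psi (R - BMS.capacity (ν s))) ≤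
            BMS.wordMMSE μ (ν t) i) := by
  obtain ⟨tR, htR, hcap⟩ := hν.surjOn_capacity (hR ▸ BMS.entropy_div_mem_Icc hN μ)
  have hcapR : BMS.capacity (ν tR) = R := hcap
  have hcapμ : BMS.capacity (ν tR) = BMS.entropy μ id / N := hcapR.trans hR
  have hlt {t : ℝ} (ht : t ∈ Set.Ico 0 tR) : R < BMS.capacity (ν t) :=
    hcapR ▸ hν.strictAntiOn_capacity ⟨ht.1, ht.2.le.trans htR.2⟩ htR ht.2
  have hpos {t : ℝ} (ht : t ∈ Set.Ioc tR 1) :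
      0 < ∫ s in tR..t, BMS.psi (R - BMS.capacity (ν s)) :=
    hcapR ▸ hν.integral_psi_pos htR.1 ht.1 ht.2
  refine ⟨fun u hu => BMS.psi_nonneg hu, BMS.strictMonoOn_psi, tR, htR, hcapR,
    fun t ht h => hν.strictAntiOn_capacity.injOn ht htR (h.trans hcapR.symm),
    fun h0 h1 => ⟨htR.1.lt_of_ne ?_, htR.2.lt_of_ne ?_⟩, fun t => hlt, fun t => hpos,
    fun i => ⟨hν.intervalIntegrable_wordMMSE_mul_one_sub μ i le_rfl zero_le_one le_rfl,
      fun t ht => ?_, fun t ht => ?_⟩⟩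
  · rintro rfl
    exact h1.ne (hcapR.symm.trans hν.capacity_zero)
  · rintro rfl
    exact h0.ne' (hcapR.symm.trans hν.capacity_one)
  · have hgap := ENNReal.ofReal_pos.2 (sub_pos.2 (hlt ht))
    rw [ENNReal.le_div_iff_mul_le (.inl hgap.ne') (.inl ENNReal.ofReal_ne_top),
      ← ENNReal.ofReal_mul (BMS.wordMMSE_mem_Icc μ i).1, hR]
    exact hν.ofReal_wordMMSE_mul_le i hμ ⟨ht.1, ht.2.le.trans htR.2⟩
  · rw [sub_le_comm, le_div_iff₀ (hpos ht), ← hcapR]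
    exact hν.one_sub_wordMMSE_mul_integral_psi_le i hμ htR.1 ht.1.le ht.2 hcapμ

theorem mainTheorem5 (ν : ℝ → MeasureTheory.Measure EReal)
    [∀ t, MeasureTheory.IsProbabilityMeasure (ν t)] (hν : BMS.IsAdmissibleFamily ν)
    (N : ℕ) (hN : 0 < N) (C : Finset (Fin N → Bool)) (hC : C.Nonempty)
    (hsymm : BMS.HasTransitiveSymmetry (BMS.codeLaw C)) (R : ℝ) (hR : R = BMS.rate C) :
    (∀ u ∈ Set.Icc (0 : ℝ) 1, 0 ≤ BMS.psi u) ∧ StrictMonoOn BMS.psi (Set.Icc 0 1) ∧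
    ∃ tR ∈ Set.Icc (0 : ℝ) 1,
      BMS.capacity (ν tR) = R ∧
      (∀ t ∈ Set.Icc (0 : ℝ) 1, BMS.capacity (ν t) = R → t = tR) ∧
      (0 < R → R < 1 → tR ∈ Set.Ioo (0 : ℝ) 1) ∧
      (∀ t ∈ Set.Ico 0 tR, R < BMS.capacity (ν t)) ∧
      (∀ t ∈ Set.Ioc tR 1, 0 < ∫ s in tR..t, BMS.psi (R - BMS.capacity (ν s))) ∧
      ∀ i : Fin N,
        IntervalIntegrable
          (fun s => BMS.extrinsicMMSE C (ν s) i * (1 - BMS.extrinsicMMSE C (ν s) i))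
          MeasureTheory.volume 0 1 ∧
        (∀ t ∈ Set.Ico 0 tR,
          ENNReal.ofReal (BMS.extrinsicMMSE C (ν t) i) ≤
            BMS.kappa ν t *
              ENNReal.ofReal (∫ s in t..1,
                BMS.extrinsicMMSE C (ν s) i * (1 - BMS.extrinsicMMSE C (ν s) i)) /
              ENNReal.ofReal (BMS.capacity (ν t) - R)) ∧
        (∀ t ∈ Set.Ioc tR 1,
          1 - (∫ s in tR..t,
                BMS.extrinsicMMSE C (ν s) i * (1 - BMS.extrinsicMMSE C (ν s) i)) /
              (∫ s in tR..t, BMS.psi (R - BMS.capacity (ν s))) ≤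
            BMS.extrinsicMMSE C (ν t) i) := by
  have := BMS.isProbabilityMeasure_codeLaw hC
  exact mainTheorem5_general ν hν N hN (BMS.codeLaw C) hsymm R
    (hR.trans (BMS.rate_eq_entropy_codeLaw_div hC))
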